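/- Theorem 1.1. Let $P\subset\mathbb R^d$ be a non-empty convex polytope that is inscribed, i.e. whose vertices lie on a common sphere, and let $c(P)\in\operatorname{aff}(P)$ denote the center of the inscribing sphere relative to the affine hull of $P$ (the unique point of $\operatorname{aff}(P)$ that is equidistant to all vertices of $P$). For an edge $e=[u,v]$ of $P$ let $C_e=\{x\in\mathbb R^d:\|x-u\|=\|x-v\|\}$ be its bisector hyperplane and $\pi_e:\mathbb R^d\to C_e$ the orthogonal projection onto $C_e$. Say that a polytope $Q$ is inscribed with center $c$ if $c\in\operatorname{aff}(Q)$ and the vertices of $Q$ lie on a common sphere around $c$ (radius $0$ is allowed, for a single point). Then the following are equivalent: (i) $P$ is a zonotope, i.e. a translate of a Minkowski sum $[-z_1,z_1]+\dots+[-z_n,z_n]$ of finitely many segments ($n\ge 0$, $z_i \in \mathbb R^d$); (ii) for every edge $e$ of $P$, the projection $\pi_e(P)$ is inscribed with center $c(P)$; (iii) for every edge $e$ of $P$, the section $P\cap C_e$ is inscribed with center $c(P)$. -/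

import Mathlib

open scoped Pointwise

namespace InscribedZonotope

variable {E : Type*} [NormedAddCommGroup E] [InnerProductSpace ℝ E]

/-- A (non-empty) convex polytope: the convex hull of a non-empty finite set of points. -/
def IsPolytope (P : Set E) : Prop :=
  ∃ S : Set E, S.Finite ∧ S.Nonempty ∧ P = convexHull ℝ S

/-- A zonotope: a translate of a Minkowski sum of finitely many segments `[-zᵢ, zᵢ]`. -/
def IsZonotope (P : Set E) : Prop :=
  ∃ (t : E) (n : ℕ) (z : Fin n → E), P = {t} + ∑ i, segment ℝ (-(z i)) (z i)

/-- The vertices of a convex set `P`, i.e. its extreme points. -/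
def vertices (P : Set E) : Set E := P.extremePoints ℝ

/-- The segment `[u, v]` is an edge of `P`: a one-dimensional face with endpoints `u ≠ v`, where
a face is the set of points of `P` that maximize a linear functional over `P`. -/
def IsEdge (P : Set E) (u v : E) : Prop :=
  u ≠ v ∧ IsExposed ℝ P (segment ℝ u v)

/-- `P` is inscribed: its vertices lie on a common sphere. -/
def IsInscribed (P : Set E) : Prop :=
  EuclideanGeometry.Cospherical (vertices P)

/-- `P` is inscribed with center `c`: the point `c` lies in the affine hull of `P` and the vertices
of `P` lie on a common sphere around `c`. -/
def IsInscribedWithCenter (P : Set E) (c : E) : Prop :=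
  c ∈ affineSpan ℝ P ∧ ∃ r : ℝ, ∀ v ∈ vertices P, dist v c = r

lemma IsPolytope.convexHull_vertices {P : Set E} (hP : IsPolytope P) :
    convexHull ℝ (vertices P) = P := by
  obtain ⟨S, hS, -, rfl⟩ := hP
  have hcl : (vertices (convexHull ℝ S)).Finite := hS.subset extremePoints_convexHull_subset
  have h : closure (convexHull ℝ (vertices (convexHull ℝ S))) = convexHull ℝ S :=
    closure_convexHull_extremePoints (hS.isCompact_convexHull ℝ) (convex_convexHull ℝ S)
  rwa [(hcl.isCompact_convexHull ℝ).isClosed.closure_eq] at h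

/-- An inscribed polytope has exactly one center in its affine hull. -/
lemma existsUnique_center [FiniteDimensional ℝ E] {P : Set E} (hP : IsPolytope P)
    (hI : IsInscribed P) : ∃! c : E, IsInscribedWithCenter P c := by
  have hspan : affineSpan ℝ (vertices P) = affineSpan ℝ P := by
    conv_rhs => rw [← hP.convexHull_vertices, affineSpan_convexHull]
  have hne : P.Nonempty := by
    obtain ⟨S, -, hS, rfl⟩ := hP
    exact hS.convexHull
  have hsub : vertices P ⊆ (affineSpan ℝ P : Set E) :=
    extremePoints_subset.trans (subset_affineSpan ℝ P)
  have : Nonempty (affineSpan ℝ P) := ((affineSpan_nonempty ℝ).2 hne).to_subtype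
  obtain ⟨c, hc, r, hr⟩ :=
    (EuclideanGeometry.cospherical_iff_exists_mem_of_finiteDimensional hsub).1 hI
  refine ⟨c, ⟨hc, r, hr⟩, ?_⟩
  rintro c' ⟨hc', r', hr'⟩
  have hle : vectorSpan ℝ (vertices P) ≤ (Submodule.span ℝ {c' - c})ᗮ := by
    rw [vectorSpan, Submodule.span_le]
    rintro _ ⟨v, hv, w, hw, rfl⟩
    rw [SetLike.mem_coe, Submodule.mem_orthogonal_singleton_iff_inner_right]
    exact EuclideanGeometry.inner_vsub_vsub_of_dist_eq_of_dist_eq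
      ((hr w hw).trans (hr v hv).symm) ((hr' w hw).trans (hr' v hv).symm)
  have hmem : c' - c ∈ vectorSpan ℝ (vertices P) := by
    rw [← direction_affineSpan, hspan]
    exact AffineSubspace.vsub_mem_direction hc' hc
  have h0 := Submodule.mem_orthogonal_singleton_iff_inner_right.1 (hle hmem)
  exact sub_eq_zero.1 (inner_self_eq_zero.1 h0)

open Classical in
/-- The center `c(P)` of the inscribing sphere relative to the affine hull of `P`
(with the value `0` if there is none). -/
noncomputable def center (P : Set E) : E :=
  if h : ∃ c : E, IsInscribedWithCenter P c then h.choose else 0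

lemma isInscribedWithCenter_center [FiniteDimensional ℝ E] {P : Set E} (hP : IsPolytope P)
    (hI : IsInscribed P) : IsInscribedWithCenter P (center P) := by
  have h := (existsUnique_center hP hI).exists
  rw [center, dif_pos h]
  exact h.choose_spec

lemma center_eq_iff [FiniteDimensional ℝ E] {P : Set E} (hP : IsPolytope P)
    (hI : IsInscribed P) {c : E} : center P = c ↔ IsInscribedWithCenter P c :=
  ⟨fun h => h ▸ isInscribedWithCenter_center hP hI, fun h =>
    (existsUnique_center hP hI).unique (isInscribedWithCenter_center hP hI) h⟩

/-- The bisector hyperplane of the segment `[u, v]`: all points equidistant to `u` and `v`. -/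
noncomputable abbrev bisector (u v : E) : AffineSubspace ℝ E :=
  AffineSubspace.perpBisector u v

instance bisector_nonempty (u v : E) : Nonempty (bisector u v) :=
  AffineSubspace.perpBisector_nonempty.to_subtype

/-- The orthogonal projection onto the bisector hyperplane of `[u, v]`. -/
noncomputable def bisectorProj [FiniteDimensional ℝ E] (u v : E) : E → E :=
  fun x => (EuclideanGeometry.orthogonalProjection (bisector u v) x : E)

end InscribedZonotope

namespace InscribedZonotope

open scoped InnerProductSpace Topology

variable {E : Type*} [NormedAddCommGroup E] [InnerProductSpace ℝ E]

/-! Put the center at the origin, so that `P` is the convex hull of a finite set `V` on a sphere.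
Every `w ∈ V` is then the unique maximizer of `⟪w, ·⟫` over `V`, and the edge graph is connected by
a simplex argument (`forall_of_isEdgeOf`).

The pivot is `HasTranslatedEdges`. It implies that a functional exposing a single vertex is
orthogonal to no edge. Hence every edge direction `d` has a nonzero sign `⟪w, d⟫` at every vertex
`w`, and walking along an edge `a b` changes only the signs of `±(a - b)`. By connectedness every
vertex is one fixed point plus a signed sum of edge directions, and the signs are compatible with
those of every functional maximized at that vertex. So the hull is the zonotope of these directions
(`HasTranslatedEdges.isZonotope`).

To obtain translated edges from projections or sections, fix an edge `u v`, let `z = u - v`, and let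
`S` be the projection of the hull along `z`, or its section by the hyperplane orthogonal to `z`. By
hypothesis the extreme points of `S` lie on a sphere, so their edge graph is connected too. Call an
extreme point `p` good if `p ± z/2` both lie in `V`; the midpoint of `u v` is good. Goodness passes
along an edge `p q` of `S`: the face of `V` belonging to it is an inscribed polygon with `p ± z/2`
as an edge, and the hypothesis, inherited by this polygon, forces the antipodal points `q ∓ z/2` to
be vertices (`ProjectionCondition.neg_mem_left`, `SectionCondition.neg_mem`,
`mem_of_face_subset_plane`).

Conversely, over an extreme point of the projection of a zonotope along an edge, the fibre is a
translate of a fixed segment whose endpoints are vertices. As these have equal norm, the fibre is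
bisected by the hyperplane. So the extreme points of the projection have equal norm and belong to
the zonotope, and projection and section coincide (`norm_eq_of_isZonotope`,
`section_eq_of_isZonotope`). -/

/-! ### Faces and edges of a finite point set -/

/-- The points of `V` at which the linear functional `⟪g, ·⟫` is maximal over `V`. -/
def face (V : Set E) (g : E) : Set E := {w | w ∈ V ∧ ∀ x ∈ V, ⟪g, x⟫_ℝ ≤ ⟪g, w⟫_ℝ}

/-- `u` and `v` are the two points of a one-dimensional face of the finite set `V`. -/
def IsEdgeOf (V : Set E) (u v : E) : Prop := u ≠ v ∧ ∃ g, face V g = {u, v}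

lemma face_subset (V : Set E) (g : E) : face V g ⊆ V := fun _ h => h.1

lemma face_nonempty {V : Set E} (hV : V.Finite) (hne : V.Nonempty) (g : E) :
    (face V g).Nonempty := by
  obtain ⟨w, hw, h⟩ := hV.exists_maximalFor (fun x => ⟪g, x⟫_ℝ) V hne
  exact ⟨w, hw, fun x hx => (le_total ⟪g, x⟫_ℝ ⟪g, w⟫_ℝ).elim id fun h' => h hx h'⟩

lemma face_inner_eq {V : Set E} {g x y : E} (hx : x ∈ face V g) (hy : y ∈ face V g) :
    ⟪g, x⟫_ℝ = ⟪g, y⟫_ℝ := le_antisymm (hy.2 x hx.1) (hx.2 y hy.1)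

lemma mem_face_of_inner_eq {V : Set E} {g x y : E} (hx : x ∈ face V g) (hy : y ∈ V)
    (h : ⟪g, x⟫_ℝ = ⟪g, y⟫_ℝ) : y ∈ face V g := ⟨hy, fun w hw => h ▸ hx.2 w hw⟩

lemma IsEdgeOf.symm {V : Set E} {u v : E} (h : IsEdgeOf V u v) : IsEdgeOf V v u :=
  ⟨h.1.symm, by simpa only [Set.pair_comm v u] using h.2⟩

lemma IsEdgeOf.left_mem {V : Set E} {u v : E} (h : IsEdgeOf V u v) : u ∈ V := by
  obtain ⟨-, g, hg⟩ := h
  exact face_subset V g (hg ▸ Set.mem_insert u {v})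

lemma IsEdgeOf.right_mem {V : Set E} {u v : E} (h : IsEdgeOf V u v) : v ∈ V := h.symm.left_mem

lemma isEdgeOf_of_lt {V : Set E} {u v g : E} (huv : u ≠ v) (hu : u ∈ V) (hv : v ∈ V)
    (h : ⟪g, u⟫_ℝ = ⟪g, v⟫_ℝ) (hlt : ∀ w ∈ V, w ≠ u → w ≠ v → ⟪g, w⟫_ℝ < ⟪g, u⟫_ℝ) :
    IsEdgeOf V u v := by
  have hle : ∀ w ∈ V, ⟪g, w⟫_ℝ ≤ ⟪g, u⟫_ℝ := fun w hw => by
    by_cases h1 : w = u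
    · rw [h1]
    by_cases h2 : w = v
    · rw [h2, h]
    exact (hlt w hw h1 h2).le
  refine ⟨huv, g, Set.ext fun w => ⟨fun hw => ?_, ?_⟩⟩
  · by_contra hc
    simp only [Set.mem_insert_iff, Set.mem_singleton_iff, not_or] at hc
    exact absurd (hw.2 u hu) (not_le.2 (hlt w hw.1 hc.1 hc.2))
  · rintro (rfl | rfl)
    · exact ⟨hu, hle⟩
    · exact ⟨hv, fun x hx => h ▸ hle x hx⟩

/-- A face of a face of a finite set is a face. -/
lemma exists_face_eq_face_face {V : Set E} (hV : V.Finite) (g h : E) :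
    ∃ ε : ℝ, 0 < ε ∧ face V (g + ε • h) = face (face V g) h := by
  have hev : ∀ᶠ ε : ℝ in 𝓝[>] 0, ∀ x ∈ V, ∀ w ∈ V, ⟪g, x⟫_ℝ < ⟪g, w⟫_ℝ →
      ⟪g + ε • h, x⟫_ℝ < ⟪g + ε • h, w⟫_ℝ := by
    refine (Set.Finite.eventually_all hV).2 fun x _ => (Set.Finite.eventually_all hV).2 fun w _ => ?_
    by_cases hxw : ⟪g, x⟫_ℝ < ⟪g, w⟫_ℝ
    · have h1 : ContinuousAt (fun ε : ℝ => ⟪g + ε • h, x⟫_ℝ) 0 := by fun_prop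
      have h2 : ContinuousAt (fun ε : ℝ => ⟪g + ε • h, w⟫_ℝ) 0 := by fun_prop
      have := h1.eventually_lt h2 (by simpa using hxw)
      exact (this.filter_mono nhdsWithin_le_nhds).mono fun _ h _ => h
    · exact Filter.Eventually.of_forall fun _ h => absurd h hxw
  obtain ⟨ε, hε, hpos⟩ := (hev.and self_mem_nhdsWithin).exists
  have hpos : 0 < ε := hpos
  refine ⟨ε, hpos, Set.ext fun w => ⟨fun hw => ?_, fun hw => ?_⟩⟩
  · have hwg : w ∈ face V g := ⟨hw.1, fun x hx => by
      by_contra hc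
      exact absurd (hw.2 x hx) (not_le.2 (hε w hw.1 x hx (not_le.1 hc)))⟩
    refine ⟨hwg, fun x hx => ?_⟩
    have := hw.2 x hx.1
    rw [inner_add_left, inner_add_left, face_inner_eq hx hwg, inner_smul_left, inner_smul_left] at this
    exact le_of_mul_le_mul_left (by simpa using this) hpos
  · refine ⟨hw.1.1, fun x hx => ?_⟩
    by_cases hxw : ⟪g, x⟫_ℝ < ⟪g, w⟫_ℝ
    · exact (hε x hx w hw.1.1 hxw).le
    · have hx' : x ∈ face V g :=
        mem_face_of_inner_eq hw.1 hx (le_antisymm (not_lt.1 hxw) (hw.1.2 x hx))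
      have := hw.2 x hx'
      rw [inner_add_left, inner_add_left, face_inner_eq hx' hw.1, inner_smul_left, inner_smul_left]
      have := mul_le_mul_of_nonneg_left this hpos.le
      simpa using this

lemma IsEdgeOf.of_face {V : Set E} (hV : V.Finite) {g u v : E}
    (h : IsEdgeOf (face V g) u v) : IsEdgeOf V u v := by
  obtain ⟨ε, -, hε⟩ := exists_face_eq_face_face hV g h.2.choose
  exact ⟨h.1, _, hε.trans h.2.choose_spec⟩

lemma inner_le_of_mem_convexHull {V : Set E} {g x : E} {M : ℝ} (h : ∀ w ∈ V, ⟪g, w⟫_ℝ ≤ M)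
    (hx : x ∈ convexHull ℝ V) : ⟪g, x⟫_ℝ ≤ M :=
  convexHull_min (t := {y | ⟪g, y⟫_ℝ ≤ M}) h
    (convex_halfSpace_le (innerSL ℝ g).isLinear M) hx

/-- A point of the convex hull at which a functional attains its maximum lies in the convex hull
of the corresponding face. -/
lemma mem_convexHull_face {V : Set E} (hV : V.Finite) {g x : E} (hx : x ∈ convexHull ℝ V)
    (h : ∀ w ∈ V, ⟪g, w⟫_ℝ ≤ ⟪g, x⟫_ℝ) : x ∈ convexHull ℝ (face V g) := by
  have hcpt : IsCompact (convexHull ℝ V) := hV.isCompact_convexHull ℝ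
  set B : Set E := {y ∈ convexHull ℝ V | ∀ w ∈ convexHull ℝ V, innerSL ℝ g w ≤ innerSL ℝ g y} with hB
  have hexp : IsExposed ℝ (convexHull ℝ V) B := fun _ => ⟨innerSL ℝ g, rfl⟩
  have hxB : x ∈ B := ⟨hx, fun w hw => inner_le_of_mem_convexHull h hw⟩
  have hsub : B.extremePoints ℝ ⊆ face V g := fun y hy => by
    have hyV : y ∈ V := extremePoints_convexHull_subset
      (hexp.isExtreme.extremePoints_subset_extremePoints hy)
    exact ⟨hyV, fun w hw => hy.1.2 w (subset_convexHull ℝ V hw)⟩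
  have hfin : (B.extremePoints ℝ).Finite := hV.subset (hsub.trans (face_subset V g))
  have hKM := closure_convexHull_extremePoints (hexp.isCompact hcpt)
    (hexp.convex (convex_convexHull ℝ V))
  rw [(hfin.isCompact_convexHull ℝ).isClosed.closure_eq] at hKM
  exact convexHull_mono hsub (hKM.ge hxB)

/-! ### Finite subsets of a sphere and their edge graph -/

lemma inner_lt_of_norm_eq {x y : E} (h : ‖x‖ = ‖y‖) (hne : x ≠ y) : ⟪x, y⟫_ℝ < ⟪x, x⟫_ℝ := by
  have h1 : 0 < ‖x - y‖ ^ 2 := by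
    have := norm_pos_iff.2 (sub_ne_zero.2 hne)
    positivity
  rw [norm_sub_sq_real, ← h] at h1
  rw [real_inner_self_eq_norm_sq]
  linarith

/-- A line meets a sphere in at most two points. -/
lemma eq_zero_or_eq_one_of_norm_eq {u a : E} {t : ℝ} (ha : a ≠ 0) (h1 : ‖u + a‖ = ‖u‖)
    (ht : ‖u + t • a‖ = ‖u‖) : t = 0 ∨ t = 1 := by
  have e1 := norm_add_sq_real u a
  have e2 := norm_add_sq_real u (t • a)
  rw [h1] at e1
  rw [ht, inner_smul_right, norm_smul, mul_pow, Real.norm_eq_abs, sq_abs] at e2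
  have h3 : t * (t - 1) * ‖a‖ ^ 2 = 0 := by linear_combination t * e1 - e2
  have h4 : ‖a‖ ^ 2 ≠ 0 := pow_ne_zero 2 (norm_ne_zero_iff.2 ha)
  rcases mul_eq_zero.1 ((mul_eq_zero.1 h3).resolve_right h4) with h | h
  · exact Or.inl h
  · exact Or.inr (sub_eq_zero.1 h)

/-- The complement of each hyperplane is open and dense, so finitely many hyperplanes cannot cover a
non-empty open set. This supplies the generic functional of the simplex step. -/
lemma exists_mem_isOpen_inner_ne_zero [FiniteDimensional ℝ E] {C : Set E} (hC : C.Finite)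
    (h0 : ∀ c ∈ C, c ≠ 0) {O : Set E} (hO : IsOpen O) (hne : O.Nonempty) :
    ∃ g ∈ O, ∀ c ∈ C, ⟪g, c⟫_ℝ ≠ 0 := by
  have hopen : ∀ c : E, IsOpen {g : E | ⟪g, c⟫_ℝ ≠ 0} := fun c =>
    isOpen_ne_fun (by fun_prop) continuous_const
  have hdense : Dense (⋂ c ∈ C, {g : E | ⟪g, c⟫_ℝ ≠ 0}) := by
    refine dense_biInter_of_isOpen (fun c _ => hopen c) hC.countable fun c hc => ?_
    have : {g : E | ⟪g, c⟫_ℝ ≠ 0} = ((ℝ ∙ c)ᗮ : Set E)ᶜ := by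
      ext g
      simp [Submodule.mem_orthogonal_singleton_iff_inner_left]
    rw [this, ← interior_eq_empty_iff_dense_compl, ← Set.not_nonempty_iff_eq_empty]
    intro hi
    have htop := Submodule.eq_top_of_nonempty_interior' _ hi
    have : c ∈ (ℝ ∙ c)ᗮ := htop ▸ Submodule.mem_top
    rw [Submodule.mem_orthogonal_singleton_iff_inner_left] at this
    exact h0 c hc (inner_self_eq_zero.1 this)
  obtain ⟨g, hg, hg'⟩ := hdense.inter_open_nonempty O hO hne
  exact ⟨g, hg, by simpa using hg'⟩

/-- The simplex step: a point of a finite subset of a sphere which does not maximize a functional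
has a neighbour with a larger value. -/
lemma exists_isEdgeOf_inner_lt [FiniteDimensional ℝ E] {V : Set E} (hV : V.Finite) {r : ℝ}
    (hr : ∀ w ∈ V, ‖w‖ = r) {p h x : E} (hp : p ∈ V) (hx : x ∈ V) (hlt : ⟪h, p⟫_ℝ < ⟪h, x⟫_ℝ) :
    ∃ q, IsEdgeOf V p q ∧ ⟪h, p⟫_ℝ < ⟪h, q⟫_ℝ := by
  set U : Set E := {y | y ∈ V ∧ ⟪h, p⟫_ℝ < ⟪h, y⟫_ℝ} with hU
  have hUV : U ⊆ V := fun y hy => hy.1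
  have hUf : U.Finite := hV.subset hUV
  -- While `g` is tilted to `g + t • h`, the point `y` ties with `p` exactly at `t = ⟪g, a y⟫`. The
  -- first tie gives the neighbour, provided that it is unique.
  set a : E → E := fun y => (⟪h, y⟫_ℝ - ⟪h, p⟫_ℝ)⁻¹ • (p - y) with ha
  set C : Set E := (fun yy : E × E => a yy.1 - a yy.2) '' ((U ×ˢ U) ∩ {yy | yy.1 ≠ yy.2}) with hCdef
  have hC : C.Finite := ((hUf.prod hUf).subset Set.inter_subset_left).image _
  -- If `a y = a y'`, then `p`, `y`, `y'` are three collinear points of a sphere.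
  have hC0 : ∀ c ∈ C, c ≠ 0 := by
    rintro _ ⟨⟨y, y'⟩, ⟨⟨hy, hy'⟩, hne⟩, rfl⟩ h0
    simp only [Set.mem_ofPred_eq] at hy hy' hne h0
    have hy1 : 0 < ⟪h, y⟫_ℝ - ⟪h, p⟫_ℝ := sub_pos.2 hy.2
    have hy1' : 0 < ⟪h, y'⟫_ℝ - ⟪h, p⟫_ℝ := sub_pos.2 hy'.2
    set s := ⟪h, y⟫_ℝ - ⟪h, p⟫_ℝ
    set s' := ⟪h, y'⟫_ℝ - ⟪h, p⟫_ℝ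
    have e : y' - p = (s' / s) • (y - p) := by
      have : s⁻¹ • (p - y) = s'⁻¹ • (p - y') := sub_eq_zero.1 h0
      have h2 : p - y' = s' • (s⁻¹ • (p - y)) := by rw [this, smul_smul, mul_inv_cancel₀ hy1'.ne', one_smul]
      rw [← neg_sub, h2, smul_smul, ← smul_neg, neg_sub, div_eq_mul_inv]
    have hyp : y ≠ p := by rintro rfl; exact lt_irrefl _ hy.2
    rcases eq_zero_or_eq_one_of_norm_eq (u := p) (a := y - p) (t := s' / s) (sub_ne_zero.2 hyp)
      (by rw [add_sub_cancel, hr y hy.1, hr p hp])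
      (by rw [← e, add_sub_cancel, hr y' hy'.1, hr p hp]) with h3 | h3
    · exact (div_pos hy1' hy1).ne' h3
    · rw [h3, one_smul] at e
      exact hne (sub_left_inj.1 e).symm
  -- The functionals uniquely maximized at `p`; this open set contains `p` itself.
  set O : Set E := ⋂ y ∈ V \ {p}, {g : E | ⟪g, y⟫_ℝ < ⟪g, p⟫_ℝ} with hOdef
  have hO : IsOpen O := (hV.subset Set.sdiff_subset).isOpen_biInter fun y _ =>
    isOpen_lt (by fun_prop) (by fun_prop)
  have hpO : p ∈ O := by
    refine Set.mem_iInter₂.2 fun y hy => ?_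
    exact inner_lt_of_norm_eq ((hr p hp).trans (hr y hy.1).symm) (Ne.symm hy.2)
  obtain ⟨g, hgO, hgC⟩ := exists_mem_isOpen_inner_ne_zero hC hC0 hO ⟨p, hpO⟩
  have hg : ∀ y ∈ V, y ≠ p → ⟪g, y⟫_ℝ < ⟪g, p⟫_ℝ := fun y hy hyp =>
    Set.mem_iInter₂.1 hgO y ⟨hy, hyp⟩
  obtain ⟨q, hq, hmin⟩ := hUf.exists_minimalFor (fun y => ⟪g, a y⟫_ℝ) U ⟨x, hx, hlt⟩
  have hmin' : ∀ y ∈ U, y ≠ q → ⟪g, a q⟫_ℝ < ⟪g, a y⟫_ℝ := fun y hy hne => by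
    refine lt_of_le_of_ne ?_ fun heq => ?_
    · exact (le_total ⟪g, a q⟫_ℝ ⟪g, a y⟫_ℝ).elim id fun h' => hmin hy h'
    · refine hgC (a q - a y) ⟨(q, y), ⟨⟨hq, hy⟩, Ne.symm hne⟩, rfl⟩ ?_
      rw [inner_sub_right, heq, sub_self]
  set t := ⟪g, a q⟫_ℝ with ht
  have hval : ∀ y ∈ U, ⟪g, p⟫_ℝ - ⟪g, y⟫_ℝ = ⟪g, a y⟫_ℝ * (⟪h, y⟫_ℝ - ⟪h, p⟫_ℝ) := fun y hy => by
    have : ⟪h, y⟫_ℝ - ⟪h, p⟫_ℝ ≠ 0 := (sub_pos.2 hy.2).ne'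
    simp only [ha, inner_smul_right, inner_sub_right]
    field_simp
  have hqp : q ≠ p := by rintro rfl; exact lt_irrefl _ hq.2
  have htpos : 0 < t := by
    have h1 := hval q hq
    have h2 := hg q hq.1 hqp
    by_contra hc
    nlinarith [hq.2]
  refine ⟨q, isEdgeOf_of_lt (g := g + t • h) hqp.symm hp hq.1 ?_ fun w hw hwp hwq => ?_, hq.2⟩
  · simp only [inner_add_left, inner_smul_left, conj_trivial]
    linarith [hval q hq]
  · simp only [inner_add_left, inner_smul_left, conj_trivial]
    by_cases hwU : w ∈ U
    · have h1 := hval w hwU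
      have h2 := hmin' w hwU hwq
      nlinarith [hwU.2]
    · have h1 : ⟪h, w⟫_ℝ ≤ ⟪h, p⟫_ℝ := not_lt.1 fun h' => hwU ⟨hw, h'⟩
      nlinarith [hg w hw hwp]

/-- The edge graph of a finite subset of a sphere is connected. -/
lemma forall_of_isEdgeOf [FiniteDimensional ℝ E] {V : Set E} (hV : V.Finite) {r : ℝ}
    (hr : ∀ w ∈ V, ‖w‖ = r) {m : E} (hm : m ∈ V) {G : E → Prop} (hGm : G m)
    (hG : ∀ p q, IsEdgeOf V p q → G p → G q) : ∀ q ∈ V, G q := by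
  by_contra! hc
  obtain ⟨x, hx, hxG⟩ := hc
  -- A counterexample closest to `m` in the direction `m` has a neighbour strictly closer, because
  -- `m` is the unique maximizer of `⟪m, ·⟫`.
  obtain ⟨q, hq, hmax⟩ := (hV.subset (Set.sep_subset V fun y => ¬ G y)).exists_maximalFor
    (fun y => ⟪m, y⟫_ℝ) _ ⟨x, hx, hxG⟩
  have hqm : m ≠ q := by rintro rfl; exact hq.2 hGm
  obtain ⟨q', he, hlt⟩ := exists_isEdgeOf_inner_lt hV hr hq.1 hm
    (inner_lt_of_norm_eq ((hr m hm).trans (hr q hq.1).symm) hqm)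
  by_cases hGq' : G q'
  · exact hq.2 (hG q' q he.symm hGq')
  · exact absurd (hmax ⟨he.right_mem, hGq'⟩ hlt.le) (not_le.2 hlt)

/-! ### Translated edges give a zonotope -/

/-- For every edge of `V`, each face of `V` orthogonal to the edge contains a translate of it. -/
def HasTranslatedEdges (V : Set E) : Prop :=
  ∀ u v, IsEdgeOf V u v → ∀ k, ⟪k, u - v⟫_ℝ = 0 → ∃ p ∈ face V k, p + (u - v) ∈ face V k

lemma face_eq_singleton {V : Set E} {r : ℝ} (hr : ∀ w ∈ V, ‖w‖ = r) {g w : E} {t : ℝ}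
    (ht : 0 < t) (hw : w ∈ face V g) : face V (g + t • w) = {w} := by
  refine Set.eq_singleton_iff_unique_mem.2 ⟨⟨hw.1, fun x hx => ?_⟩, fun x hx => ?_⟩
  · simp only [inner_add_left, inner_smul_left, conj_trivial]
    have h1 := hw.2 x hx
    by_cases hxw : w = x
    · rw [hxw]
    have h2 := inner_lt_of_norm_eq ((hr w hw.1).trans (hr x hx).symm) hxw
    nlinarith
  · by_contra hne
    have h1 := hw.2 x hx.1
    have h2 := inner_lt_of_norm_eq ((hr w hw.1).trans (hr x hx.1).symm) (Ne.symm hne)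
    have h3 := hx.2 w hw.1
    simp only [inner_add_left, inner_smul_left, conj_trivial] at h3
    nlinarith

/-- A face orthogonal to an edge contains two distinct points, hence is not a single vertex. -/
lemma HasTranslatedEdges.inner_ne_zero {V : Set E} (hB : HasTranslatedEdges V) {u v k w : E}
    (he : IsEdgeOf V u v) (hk : face V k = {w}) : ⟪k, u - v⟫_ℝ ≠ 0 := fun h0 => by
  obtain ⟨p, hp, hp'⟩ := hB u v he k h0
  rw [hk, Set.mem_singleton_iff] at hp hp'
  rw [hp, add_eq_left, sub_eq_zero] at hp'
  exact he.1 hp'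

lemma HasTranslatedEdges.inner_mem_ne_zero {V : Set E} (hB : HasTranslatedEdges V) {r : ℝ}
    (hr : ∀ w ∈ V, ‖w‖ = r) {u v w : E} (he : IsEdgeOf V u v) (hw : w ∈ V) :
    ⟪w, u - v⟫_ℝ ≠ 0 := by
  refine hB.inner_ne_zero he (w := w) ?_
  have h := face_eq_singleton (g := 0) hr one_pos (w := w) ⟨hw, fun x _ => by simp⟩
  simpa using h

/-- If the signs were opposite, some `g + t • w` with `t > 0` would be orthogonal to the edge,
although it exposes only the vertex `w`. -/
lemma HasTranslatedEdges.inner_mul_inner_nonneg {V : Set E} (hB : HasTranslatedEdges V) {r : ℝ}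
    (hr : ∀ w ∈ V, ‖w‖ = r) {u v g w : E} (he : IsEdgeOf V u v) (hw : w ∈ face V g) :
    0 ≤ ⟪g, u - v⟫_ℝ * ⟪w, u - v⟫_ℝ := by
  by_contra! hneg
  have hne := hB.inner_mem_ne_zero hr he hw.1
  have ht : 0 < -⟪g, u - v⟫_ℝ / ⟪w, u - v⟫_ℝ := by
    rw [← mul_div_mul_right _ _ hne]
    exact div_pos (by linarith) (mul_self_pos.2 hne)
  refine hB.inner_ne_zero he (face_eq_singleton hr ht hw) ?_
  rw [inner_add_left, inner_smul_left, conj_trivial, div_mul_cancel₀ _ hne, add_neg_cancel]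

/-- The functional `g` exposing `a b` must have the sign of `u - v` at both `a` and `b`. If these
signs differ, `g` is orthogonal to `u - v`, so the two-point face `{a, b}` contains a translate of
`u v`. -/
lemma HasTranslatedEdges.eq_or_eq_neg {V : Set E} (hB : HasTranslatedEdges V) {r : ℝ}
    (hr : ∀ w ∈ V, ‖w‖ = r) {u v a b : E} (hab : IsEdgeOf V a b) (he : IsEdgeOf V u v)
    (h : ⟪a, u - v⟫_ℝ * ⟪b, u - v⟫_ℝ < 0) : u - v = a - b ∨ u - v = -(a - b) := by
  obtain ⟨g, hg⟩ := hab.2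
  have h1 := hB.inner_mul_inner_nonneg hr he (g := g) (w := a) (by simp [hg])
  have h2 := hB.inner_mul_inner_nonneg hr he (g := g) (w := b) (by simp [hg])
  have h0 : ⟪g, u - v⟫_ℝ = 0 := by
    by_contra hc
    nlinarith [mul_nonneg h1 h2, mul_self_pos.2 hc]
  obtain ⟨p, hp, hp'⟩ := hB u v he g h0
  rw [hg, Set.mem_insert_iff, Set.mem_singleton_iff] at hp hp'
  have huv := sub_ne_zero.2 he.1
  rcases hp with rfl | rfl <;> rcases hp' with h' | h'
  · exact absurd (add_eq_left.1 h') huv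
  · exact Or.inr (by rw [← h']; abel)
  · exact Or.inl (by rw [← h']; abel)
  · exact absurd (add_eq_left.1 h') huv

lemma norm_inner_sub_pos {u v : E} (h : ‖u‖ = ‖v‖) (hne : u ≠ v) :
    0 < ⟪u, u - v⟫_ℝ ∧ ⟪v, u - v⟫_ℝ < 0 := by
  have h1 := inner_lt_of_norm_eq h hne
  have h2 := inner_lt_of_norm_eq h.symm hne.symm
  rw [inner_sub_right, inner_sub_right]
  constructor <;> linarith

lemma isZonotope_of_finset (t : E) (D : Finset E) (c : ℝ) :
    IsZonotope ({t} + ∑ d ∈ D, segment ℝ (-(c • d)) (c • d)) := by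
  refine ⟨t, D.card, fun i => c • (D.equivFin.symm i : E), ?_⟩
  congr 1
  rw [← Finset.sum_coe_sort D]
  exact (Equiv.sum_comp D.equivFin.symm fun d : D => segment ℝ (-(c • (d : E))) (c • (d : E))).symm

lemma inner_le_of_mem_segment_neg {g y x : E} (hx : x ∈ segment ℝ (-y) y) :
    ⟪g, x⟫_ℝ ≤ |⟪g, y⟫_ℝ| := by
  obtain ⟨a, b, ha, hb, hab, rfl⟩ := hx
  simp only [inner_add_right, inner_smul_right, inner_neg_right]
  nlinarith [neg_abs_le ⟪g, y⟫_ℝ, le_abs_self ⟪g, y⟫_ℝ]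

lemma smul_mem_segment_neg {s : ℝ} (hs : |s| ≤ 1) (y : E) : s • y ∈ segment ℝ (-y) y := by
  obtain ⟨h1, h2⟩ := abs_le.1 hs
  refine ⟨(1 - s) / 2, (1 + s) / 2, by linarith, by linarith, by ring, ?_⟩
  rw [smul_neg, ← neg_smul, ← add_smul]
  congr 1
  ring

/-- A polytope inscribed in a sphere in which every edge is translated along all orthogonal faces
is a zonotope. -/
theorem HasTranslatedEdges.isZonotope [FiniteDimensional ℝ E] {V : Set E} (hV : V.Finite)
    (hne : V.Nonempty) {r : ℝ} (hr : ∀ w ∈ V, ‖w‖ = r) (hB : HasTranslatedEdges V) :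
    IsZonotope (convexHull ℝ V) := by
  classical
  have hDf : {d : E | ∃ u v, IsEdgeOf V u v ∧ d = u - v}.Finite := by
    refine ((hV.prod hV).image fun p : E × E => p.1 - p.2).subset ?_
    rintro _ ⟨u, v, he, rfl⟩
    exact ⟨(u, v), ⟨he.left_mem, he.right_mem⟩, rfl⟩
  set D : Finset E := hDf.toFinset with hDdef
  have hD : ∀ d, d ∈ D ↔ ∃ u v, IsEdgeOf V u v ∧ d = u - v := fun d => by simp [hDdef]
  set s : E → E → ℝ := fun w d => (SignType.sign ⟪w, d⟫_ℝ : ℝ) with hs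
  -- `D` contains `-d` along with `d`, and both contribute the same vector. With weight `1 / 4`,
  -- changing the sign of such a pair from `-1` to `1` adds exactly `d` to the sum.
  set τ : E → E := fun w => w - ∑ d ∈ D, s w d • ((1 / 4 : ℝ) • d) with hτ
  have hs1 : ∀ w d, |s w d| ≤ 1 := fun w d => by
    simp only [hs]
    rcases lt_trichotomy ⟪w, d⟫_ℝ 0 with h | h | h
    · simp [sign_neg h]
    · simp [h]
    · simp [sign_pos h]
  have hedge : ∀ u v, IsEdgeOf V u v → τ u = τ v := fun u v he => by
    have hz : u - v ≠ 0 := sub_ne_zero.2 he.1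
    have hmem : u - v ∈ D := (hD _).2 ⟨u, v, he, rfl⟩
    have hmem' : -(u - v) ∈ D := (hD _).2 ⟨v, u, he.symm, by abel⟩
    have hpos := norm_inner_sub_pos ((hr u he.left_mem).trans (hr v he.right_mem).symm) he.1
    have hsum : ∑ d ∈ D, (s u d - s v d) • ((1 / 4 : ℝ) • d) = u - v := by
      rw [← Finset.sum_subset (s₁ := {u - v, -(u - v)})]
      · have hne' : u - v ≠ -(u - v) := fun h => hz (by
          rw [eq_neg_iff_add_eq_zero, ← two_smul ℝ] at h
          exact (smul_eq_zero.1 h).resolve_left two_ne_zero)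
        rw [Finset.sum_pair hne']
        simp only [hs, inner_neg_right, sign_pos hpos.1, sign_neg hpos.2, Left.sign_neg,
          SignType.coe_one, SignType.coe_neg, smul_neg, smul_smul, ← add_smul, ← neg_smul]
        norm_num
      · intro d hd
        simp only [Finset.mem_insert, Finset.mem_singleton] at hd
        rcases hd with rfl | rfl <;> assumption
      · intro d hd hd'
        obtain ⟨a, b, hab, rfl⟩ := (hD d).1 hd
        have h1 := hB.inner_mem_ne_zero hr hab he.left_mem
        have h2 := hB.inner_mem_ne_zero hr hab he.right_mem
        have h3 : s u (a - b) = s v (a - b) := by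
          by_contra hc
          apply hd'
          simp only [Finset.mem_insert, Finset.mem_singleton]
          refine hB.eq_or_eq_neg hr he hab ?_
          rcases lt_or_gt_of_ne h1 with h1 | h1 <;> rcases lt_or_gt_of_ne h2 with h2 | h2
          · exact absurd (by simp only [hs, sign_neg h1, sign_neg h2]) hc
          · exact mul_neg_of_neg_of_pos h1 h2
          · exact mul_neg_of_pos_of_neg h1 h2
          · exact absurd (by simp only [hs, sign_pos h1, sign_pos h2]) hc
        rw [h3, sub_self, zero_smul]
    have h4 : τ u - τ v = (u - v) - ∑ d ∈ D, (s u d - s v d) • ((1 / 4 : ℝ) • d) := by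
      simp only [hτ, sub_smul, Finset.sum_sub_distrib]
      abel
    rw [hsum, sub_self, sub_eq_zero] at h4
    exact h4
  obtain ⟨w₀, hw₀⟩ := hne
  have hconst : ∀ w ∈ V, τ w = τ w₀ :=
    forall_of_isEdgeOf hV hr hw₀ (G := fun w => τ w = τ w₀) rfl
      fun p q he hp => (hedge p q he).symm.trans hp
  have hrep : ∀ w ∈ V, w = τ w₀ + ∑ d ∈ D, s w d • ((1 / 4 : ℝ) • d) := fun w hw => by
    rw [← hconst w hw]
    simp only [hτ, sub_add_cancel]
  have hP : convexHull ℝ V =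
      {τ w₀} + ∑ d ∈ D, segment ℝ (-((1 / 4 : ℝ) • d)) ((1 / 4 : ℝ) • d) := by
    refine Set.Subset.antisymm (convexHull_min (fun w hw => ?_) ?_) fun x hx => ?_
    · rw [hrep w hw]
      exact Set.add_mem_add rfl (Set.finsetSum_mem_finsetSum _ _ _ fun d _ =>
        smul_mem_segment_neg (hs1 w d) _)
    · exact (convex_singleton _).add (convex_sum _ fun d _ => convex_segment _ _)
    · by_contra hxV
      obtain ⟨f, a, hfa, hax⟩ := geometric_hahn_banach_closed_point (convex_convexHull ℝ V)
        (hV.isCompact_convexHull ℝ).isClosed hxV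
      set g := (InnerProductSpace.toDual ℝ E).symm f
      have hfg : ∀ y, f y = ⟪g, y⟫_ℝ := fun y =>
        (InnerProductSpace.toDual_symm_apply (x := y) (y := f)).symm
      obtain ⟨w, hw⟩ := face_nonempty hV ⟨w₀, hw₀⟩ g
      have h1 := hfa w (subset_convexHull ℝ V hw.1)
      rw [hfg] at h1 hax
      obtain ⟨_, rfl, y, hy, rfl⟩ := Set.mem_add.1 hx
      obtain ⟨y', hy', rfl⟩ := (Set.mem_finsetSum D _ _).1 hy
      rw [hrep w hw.1] at h1
      rw [inner_add_right, inner_sum] at h1 hax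
      -- The signs of `⟪g, d⟫` and `⟪w, d⟫` are compatible, so the vertex `w` maximizes `g` on every
      -- summand separately, and no point of the zonotope exceeds it.
      have h2 : ∑ d ∈ D, ⟪g, y' d⟫_ℝ ≤ ∑ d ∈ D, ⟪g, s w d • ((1 / 4 : ℝ) • d)⟫_ℝ := by
        refine Finset.sum_le_sum fun d hd => (inner_le_of_mem_segment_neg (hy' hd)).trans_eq ?_
        obtain ⟨u, v, he, rfl⟩ := (hD d).1 hd
        have h3 := hB.inner_mul_inner_nonneg hr he hw
        have h4 := hB.inner_mem_ne_zero hr he hw.1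
        rw [inner_smul_right, inner_smul_right, abs_mul, abs_of_pos (by norm_num : (0 : ℝ) < 1 / 4)]
        simp only [hs]
        rcases lt_or_gt_of_ne h4 with h4 | h4
        · rw [sign_neg h4, abs_of_nonpos (by nlinarith)]
          simp [inner_smul_right]
        · rw [sign_pos h4, abs_of_nonneg (by nlinarith)]
          simp [inner_smul_right]
      linarith
  rw [hP]
  exact isZonotope_of_finset _ _ _

/-! ### Lines and circles in a plane -/

lemma exists_smul_add_smul_eq {T : Submodule ℝ E} (hT : Module.finrank ℝ T = 2) {a b x : E}
    (ha : a ∈ T) (hb : b ∈ T) (hli : LinearIndependent ℝ ![a, b]) (hx : x ∈ T) :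
    ∃ s t : ℝ, s • a + t • b = x := by
  have : FiniteDimensional ℝ T := Module.finite_of_finrank_eq_succ hT
  have hle : Submodule.span ℝ {a, b} ≤ T := Submodule.span_le.2 (Set.pair_subset ha hb)
  have hfr : Module.finrank ℝ (Submodule.span ℝ {a, b}) = 2 := by
    have := finrank_span_eq_card hli
    rwa [Matrix.range_cons, Matrix.range_cons, Matrix.range_empty, Set.union_empty,
      Set.singleton_union, Fintype.card_fin] at this
  rw [← Submodule.eq_of_le_of_finrank_eq hle (hfr.trans hT.symm)] at hx
  exact Submodule.mem_span_pair.1 hx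

lemma linearIndependent_pair_of_inner {k a b : E} (ha : a ≠ 0) (hka : ⟪k, a⟫_ℝ = 0)
    (hkb : ⟪k, b⟫_ℝ ≠ 0) : LinearIndependent ℝ ![a, b] := by
  refine LinearIndependent.pair_iff.2 fun s t h => ?_
  have h1 : ⟪k, s • a + t • b⟫_ℝ = 0 := by rw [h, inner_zero_right]
  rw [inner_add_right, inner_smul_right, inner_smul_right, hka, mul_zero, zero_add] at h1
  have ht := (mul_eq_zero.1 h1).resolve_right hkb
  rw [ht, zero_smul, add_zero] at h
  exact ⟨(smul_eq_zero.1 h).resolve_right ha, ht⟩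

lemma exists_eq_smul_of_inner_eq_zero {T : Submodule ℝ E} (hT : Module.finrank ℝ T = 2)
    {k t₀ a x : E} (ht₀ : t₀ ∈ T) (hk : ⟪k, t₀⟫_ℝ ≠ 0) (ha : a ∈ T) (ha0 : a ≠ 0)
    (hka : ⟪k, a⟫_ℝ = 0) (hx : x ∈ T) (hkx : ⟪k, x⟫_ℝ = 0) : ∃ s : ℝ, x = s • a := by
  obtain ⟨s, t, rfl⟩ := exists_smul_add_smul_eq hT ha ht₀
    (linearIndependent_pair_of_inner ha0 hka hk) hx
  rw [inner_add_right, inner_smul_right, inner_smul_right, hka, mul_zero, zero_add] at hkx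
  rw [(mul_eq_zero.1 hkx).resolve_right hk, zero_smul, add_zero]
  exact ⟨s, rfl⟩

/-- A level line of a functional meets a circle in at most two points. -/
lemma eq_or_eq_of_inner_eq {T : Submodule ℝ E} (hT : Module.finrank ℝ T = 2)
    {k t₀ u v x : E} (ht₀ : t₀ ∈ T) (hk : ⟪k, t₀⟫_ℝ ≠ 0) (hu : u ∈ T) (hv : v ∈ T) (hx : x ∈ T)
    (huv : u ≠ v) (hn : ‖v‖ = ‖u‖) (hnx : ‖x‖ = ‖u‖) (hkv : ⟪k, v⟫_ℝ = ⟪k, u⟫_ℝ)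
    (hkx : ⟪k, x⟫_ℝ = ⟪k, u⟫_ℝ) : x = u ∨ x = v := by
  obtain ⟨s, hs⟩ := exists_eq_smul_of_inner_eq_zero hT ht₀ hk (T.sub_mem hv hu)
    (sub_ne_zero.2 huv.symm) (by rw [inner_sub_right, hkv, sub_self]) (T.sub_mem hx hu)
    (by rw [inner_sub_right, hkx, sub_self])
  rcases eq_zero_or_eq_one_of_norm_eq (u := u) (sub_ne_zero.2 huv.symm)
    (by rwa [add_sub_cancel]) (by rwa [← hs, add_sub_cancel]) with rfl | rfl
  · exact Or.inl (sub_eq_zero.1 (by rw [hs, zero_smul]))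
  · exact Or.inr (sub_left_inj.1 (by rw [hs, one_smul]))

lemma inner_sub_eq_half_norm_sq {u v : E} (h : ‖v‖ = ‖u‖) : ⟪u, u - v⟫_ℝ = ‖u - v‖ ^ 2 / 2 := by
  have := norm_sub_sq_real u v
  rw [inner_sub_right, real_inner_self_eq_norm_sq]
  rw [h] at this
  linarith

lemma inner_add_sub_eq_zero {u v : E} (h : ‖v‖ = ‖u‖) : ⟪u + v, u - v⟫_ℝ = 0 :=
  (real_inner_add_sub_eq_zero_iff u v).2 h.symm

/-- The points `u` and `-v` lie on the same level line of `⟪u - v, ·⟫`, which meets the circle in no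
further point. If `u = -v` the line is tangent, and the strict Cauchy–Schwarz inequality takes over.
-/
lemma eq_or_eq_neg_of_inner_eq {T : Submodule ℝ E} (hT : Module.finrank ℝ T = 2) {u v x : E}
    (hu : u ∈ T) (hv : v ∈ T) (hx : x ∈ T) (huv : u ≠ v) (hn : ‖v‖ = ‖u‖) (hnx : ‖x‖ = ‖u‖)
    (h : ⟪x, u - v⟫_ℝ = ‖u - v‖ ^ 2 / 2) : x = u ∨ x = -v := by
  have h1 := inner_sub_eq_half_norm_sq hn
  by_cases h0 : u = -v
  · left
    by_contra hne
    have h2 := inner_lt_of_norm_eq hnx hne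
    have h3 : u - v = (2 : ℝ) • u := by rw [h0, two_smul]; abel
    rw [← h1, h3, inner_smul_right, inner_smul_right, real_inner_self_eq_norm_sq] at h
    rw [real_inner_self_eq_norm_sq, hnx] at h2
    linarith
  · refine eq_or_eq_of_inner_eq hT (k := u - v) (T.sub_mem hu hv) ?_ hu (T.neg_mem hv) hx h0
      (by rwa [norm_neg]) hnx ?_ ?_
    · exact fun hc => huv (sub_eq_zero.1 (inner_self_eq_zero.1 hc))
    · have := inner_add_sub_eq_zero hn
      rw [inner_add_left] at this
      rw [inner_neg_right, real_inner_comm v, real_inner_comm u]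
      linarith
    · rw [real_inner_comm x, real_inner_comm u, h, h1]

/-! ### Central symmetry of inscribed polygons -/

/-- Orthogonal projections along edges have all their vertices at the distance of the image of the
edge, in terms of the finite set of vertices. -/
def ProjectionCondition (V : Set E) : Prop :=
  ∀ u v, IsEdgeOf V u v → ∀ k, ⟪k, u - v⟫_ℝ = 0 →
    (∀ x ∈ face V k, ∀ y ∈ face V k, ∃ t : ℝ, x - y = t • (u - v)) →
    ∀ w ∈ face V k, |⟪w, u - v⟫_ℝ| = ‖u - v‖ ^ 2 / 2

/-- Edges cross the bisector of a given edge at the distance of its midpoint, and no vertices lie on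
the bisector. -/
def SectionCondition (V : Set E) : Prop :=
  ∀ u v, IsEdgeOf V u v → (∀ w ∈ V, ⟪w, u - v⟫_ℝ ≠ 0) ∧
    ∀ a b, IsEdgeOf V a b → ∀ q ∈ segment ℝ a b, ⟪q, u - v⟫_ℝ = 0 → ‖q‖ = ‖u + v‖ / 2

/-- The polygon projects along `u v` to a segment, and the face opposite to `u v` collapses to its
other end. The condition leaves only `±u` and `±v` for a point of that face, and `u`, `v` are
excluded because `x` makes `g` nonconstant on `W`. -/
lemma ProjectionCondition.face_neg_subset {W : Set E} (hH : ProjectionCondition W)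
    {T : Submodule ℝ E} (hT : Module.finrank ℝ T = 2) (hWT : W ⊆ T) {r : ℝ}
    (hr : ∀ w ∈ W, ‖w‖ = r) {u v x g : E} (huv : u ≠ v) (hg : face W g = {u, v})
    (hx : x ∈ W) (hxu : x ≠ u) (hxv : x ≠ v) : face W (-g) ⊆ {-u, -v} := by
  have hu : u ∈ face W g := by simp [hg]
  have hv : v ∈ face W g := by simp [hg]
  have hgz : ⟪g, u - v⟫_ℝ = 0 := by rw [inner_sub_right, face_inner_eq hu hv, sub_self]
  have hlt : ⟪g, x⟫_ℝ < ⟪g, u⟫_ℝ := by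
    refine lt_of_le_of_ne (hu.2 x hx) fun h => ?_
    have := mem_face_of_inner_eq hu hx h.symm
    rw [hg] at this
    rcases this with h | h
    · exact hxu h
    · exact hxv h
  intro w hw
  have habs := hH u v ⟨huv, g, hg⟩ (-g) (by rw [inner_neg_left, hgz, neg_zero])
    (fun a ha b hb => exists_eq_smul_of_inner_eq_zero hT (k := g) (t₀ := u - x)
      (T.sub_mem (hWT hu.1) (hWT hx)) (by rw [inner_sub_right]; linarith)
      (T.sub_mem (hWT hu.1) (hWT hv.1)) (sub_ne_zero.2 huv) hgz
      (T.sub_mem (hWT ha.1) (hWT hb.1)) (by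
        have := face_inner_eq ha hb
        rw [inner_neg_left, inner_neg_left, neg_inj] at this
        rw [inner_sub_right, this, sub_self])) w hw
  have hn : ‖v‖ = ‖u‖ := (hr v hv.1).trans (hr u hu.1).symm
  have hnw : ‖w‖ = ‖u‖ := (hr w hw.1).trans (hr u hu.1).symm
  have hnot : ∀ y ∈ face W g, w ≠ y := by
    rintro y hy rfl
    have h1 := hw.2 x hx
    rw [inner_neg_left, inner_neg_left] at h1
    have h2 := face_inner_eq hu hy
    linarith
  rcases abs_eq (by positivity) |>.1 habs with h | h
  · rcases eq_or_eq_neg_of_inner_eq hT (hWT hu.1) (hWT hv.1) (hWT hw.1) huv hn hnw h with h | h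
    · exact absurd h (hnot u hu)
    · exact Or.inr h
  · rcases eq_or_eq_neg_of_inner_eq hT (hWT hu.1) (hWT hv.1) (T.neg_mem (hWT hw.1)) huv hn
      (by rwa [norm_neg]) (by rw [inner_neg_left, h, neg_neg]) with h | h
    · exact Or.inl (by rw [← h, neg_neg])
    · exact absurd (neg_inj.1 h) (hnot v hv)

/-- A point of a circle in the cone spanned at `u` by two chords `a`, `b` lies on the far side of
the line through the other endpoints of the chords. -/
lemma one_lt_add_of_norm_eq {u a b : E} {β γ : ℝ} (ha : ‖u + a‖ = ‖u‖) (hb : ‖u + b‖ = ‖u‖)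
    (h : ‖u + (β • a + γ • b)‖ = ‖u‖) (hab : a ≠ b) (ha0 : a ≠ 0) (hb0 : b ≠ 0) (hβ : 0 ≤ β)
    (hγ : 0 ≤ γ) (h0 : β • a + γ • b ≠ 0) (h1 : β • a + γ • b ≠ a) (h2 : β • a + γ • b ≠ b) :
    1 < β + γ := by
  have e1 := norm_add_sq_real u a
  have e2 := norm_add_sq_real u b
  have e3 := norm_add_sq_real u (β • a + γ • b)
  have e4 := norm_add_sq_real (β • a) (γ • b)
  have e5 := norm_sub_sq_real a b
  rw [ha] at e1
  rw [hb] at e2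
  rw [h, inner_add_right, inner_smul_right, inner_smul_right] at e3
  rw [norm_smul, norm_smul, mul_pow, mul_pow, Real.norm_eq_abs, Real.norm_eq_abs, sq_abs, sq_abs,
    inner_smul_left, inner_smul_right, conj_trivial] at e4
  have hA : 0 < ‖a‖ ^ 2 := by have := norm_pos_iff.2 ha0; positivity
  have hB : 0 < ‖b‖ ^ 2 := by have := norm_pos_iff.2 hb0; positivity
  have hD : 0 < ‖a - b‖ ^ 2 := by have := norm_pos_iff.2 (sub_ne_zero.2 hab); positivity
  -- The three circle conditions express `‖a‖ ^ 2`, `‖b‖ ^ 2` and `‖β • a + γ • b‖ ^ 2` through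
  -- inner products with `u`; eliminating `u` leaves this identity.
  have key : (β + γ - 1) * (β * ‖a‖ ^ 2 + γ * ‖b‖ ^ 2) = β * γ * ‖a - b‖ ^ 2 := by
    rw [e5]
    linear_combination -e3 - e4 + β * e1 + γ * e2
  rcases hβ.eq_or_lt with rfl | hβ
  · rcases hγ.eq_or_lt with rfl | hγ
    · simp at h0
    · have : (γ - 1) * (γ * ‖b‖ ^ 2) = 0 := by linear_combination key
      have hγ1 : γ = 1 := by
        have := (mul_eq_zero.1 this).resolve_right (by positivity)
        linarith
      simp [hγ1] at h2
  · rcases hγ.eq_or_lt with rfl | hγ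
    · have : (β - 1) * (β * ‖a‖ ^ 2) = 0 := by linear_combination key
      have hβ1 : β = 1 := by
        have := (mul_eq_zero.1 this).resolve_right (by positivity)
        linarith
      simp [hβ1] at h1
    · have h3 : 0 < (β + γ - 1) * (β * ‖a‖ ^ 2 + γ * ‖b‖ ^ 2) := by rw [key]; positivity
      have := pos_of_mul_pos_left h3 (by positivity)
      linarith

/-- If `-u` is missing, the face opposite to an edge `u y` can only be `{-y}`. Applied to two edges
`u v` and `u w`, this puts `-v` and `-w` in `W`, where they form an edge. The face opposite to this
edge should lie in `{v, w}`, but `u` lies beyond the line through `v` and `w`. -/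
lemma ProjectionCondition.neg_mem_left [FiniteDimensional ℝ E] {W : Set E}
    (hH : ProjectionCondition W) (hW : W.Finite)
    {T : Submodule ℝ E} (hT : Module.finrank ℝ T = 2) (hWT : W ⊆ T) {r : ℝ}
    (hr : ∀ w ∈ W, ‖w‖ = r) {u v x : E} (he : IsEdgeOf W u v)
    (hx : x ∈ W) (hxu : x ≠ u) (hxv : x ≠ v) : -u ∈ W := by
  by_contra hnu
  have hopp : ∀ {y g x : E}, u ≠ y → face W g = {u, y} → x ∈ W → x ≠ u → x ≠ y →
      -y ∈ face W (-g) := fun {y g x} huy hg hx hxu hxy => by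
    obtain ⟨w, hw⟩ := face_nonempty hW ⟨x, hx⟩ (-g)
    rcases hH.face_neg_subset hT hWT hr huy hg hx hxu hxy hw with h | h
    · exact absurd (h ▸ hw.1) hnu
    · exact h ▸ hw
  have hlt : ∀ {y g x : E}, face W g = {u, y} → x ∈ W → x ≠ u → x ≠ y → ⟪g, x⟫_ℝ < ⟪g, u⟫_ℝ :=
    fun {y g x} hg hx hxu hxy => by
      have hu : u ∈ face W g := by simp [hg]
      refine lt_of_le_of_ne (hu.2 x hx) fun h => ?_
      have := mem_face_of_inner_eq hu hx h.symm
      rw [hg] at this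
      rcases this with h | h
      · exact hxu h
      · exact hxy h
  have heq : ∀ {y g : E}, face W g = {u, y} → ⟪g, y⟫_ℝ = ⟪g, u⟫_ℝ := fun {y g} hg =>
    face_inner_eq (by simp [hg]) (by simp [hg] : u ∈ face W g)
  obtain ⟨huv, g₁, hg₁⟩ := id he
  obtain ⟨w, hew, hw⟩ := exists_isEdgeOf_inner_lt hW hr (p := u) (h := -g₁) (x := x) he.left_mem hx
    (by
      rw [inner_neg_left, inner_neg_left]
      exact neg_lt_neg (hlt hg₁ hx hxu hxv))
  obtain ⟨huw, g₂, hg₂⟩ := id hew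
  rw [inner_neg_left, inner_neg_left, neg_lt_neg_iff] at hw
  have hwv : w ≠ v := by
    rintro rfl
    exact hw.ne (heq hg₁)
  have hv' := hopp huv hg₁ hx hxu hxv
  have hw' := hopp huw hg₂ he.right_mem huv.symm hwv.symm
  have hvlt : ⟪g₂, v⟫_ℝ < ⟪g₂, u⟫_ℝ := hlt hg₂ he.right_mem huv.symm hwv.symm
  set c₁ := ⟪g₁, u⟫_ℝ - ⟪g₁, w⟫_ℝ with hc₁
  set c₂ := ⟪g₂, u⟫_ℝ - ⟪g₂, v⟫_ℝ with hc₂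
  have hc₁p : 0 < c₁ := sub_pos.2 hw
  have hc₂p : 0 < c₂ := sub_pos.2 hvlt
  -- Normalized so that `k` grows by `1` from `u` to `v` and from `u` to `w`; then `β + γ` below is
  -- the growth of `k` from `u` to `-y`.
  set k := -(c₁⁻¹ • g₁ + c₂⁻¹ • g₂) with hk
  have hkval : ∀ y, ⟪k, y⟫_ℝ = -(c₁⁻¹ * ⟪g₁, y⟫_ℝ + c₂⁻¹ * ⟪g₂, y⟫_ℝ) := fun y => by
    rw [hk, inner_neg_left, inner_add_left, inner_smul_left, inner_smul_left]
    rfl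
  have hkv : ⟪k, v⟫_ℝ = ⟪k, u⟫_ℝ + 1 := by
    have : ⟪g₂, v⟫_ℝ = ⟪g₂, u⟫_ℝ - c₂ := by ring
    rw [hkval, hkval, heq hg₁, this]
    field_simp
    ring
  have hkw : ⟪k, w⟫_ℝ = ⟪k, u⟫_ℝ + 1 := by
    have : ⟪g₁, w⟫_ℝ = ⟪g₁, u⟫_ℝ - c₁ := by ring
    rw [hkval, hkval, heq hg₂, this]
    field_simp
    ring
  have hli : LinearIndependent ℝ ![v - u, w - u] := by
    refine linearIndependent_pair_of_inner (k := g₁) (sub_ne_zero.2 huv.symm) ?_ ?_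
    · rw [inner_sub_right, heq hg₁, sub_self]
    · rw [inner_sub_right]
      linarith
  -- Since `-v` and `-w` minimize `g₁` and `g₂` over `W`, the point `-y` lies in the cone at `u`
  -- spanned by `v - u` and `w - u`. Being on the circle, it lies beyond the chord `v w`.
  have hrel : ∀ y ∈ W, -y ∉ ({v, w} : Set E) → ⟪k, v⟫_ℝ < ⟪k, -y⟫_ℝ := fun y hy hyvw => by
    simp only [Set.mem_insert_iff, Set.mem_singleton_iff, not_or] at hyvw
    obtain ⟨β, γ, hβγ⟩ := exists_smul_add_smul_eq hT (T.sub_mem (hWT he.right_mem) (hWT he.left_mem))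
      (T.sub_mem (hWT hew.right_mem) (hWT he.left_mem)) hli
      (T.sub_mem (T.neg_mem (hWT hy)) (hWT he.left_mem))
    have h1 : ∀ g, ⟪g, -y⟫_ℝ = ⟪g, u⟫_ℝ + (β * (⟪g, v⟫_ℝ - ⟪g, u⟫_ℝ) + γ * (⟪g, w⟫_ℝ - ⟪g, u⟫_ℝ)) :=
      fun g => by
        rw [← inner_sub_right, ← inner_sub_right, ← inner_smul_right, ← inner_smul_right,
          ← inner_add_right, hβγ, ← inner_add_right, add_sub_cancel]
    have hγ : 0 ≤ γ := by
      have h2 := hv'.2 y hy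
      have h3 := h1 g₁
      rw [inner_neg_left, inner_neg_left, inner_neg_right, neg_neg, heq hg₁] at h2
      rw [heq hg₁, inner_neg_right] at h3
      by_contra hc
      nlinarith
    have hβ : 0 ≤ β := by
      have h2 := hw'.2 y hy
      have h3 := h1 g₂
      rw [inner_neg_left, inner_neg_left, inner_neg_right, neg_neg, heq hg₂] at h2
      rw [heq hg₂, inner_neg_right] at h3
      by_contra hc
      nlinarith
    have hnr : ∀ x ∈ W, ‖x‖ = ‖u‖ := fun x hx => (hr x hx).trans (hr u he.left_mem).symm
    have h4 := one_lt_add_of_norm_eq (u := u) (a := v - u) (b := w - u) (β := β) (γ := γ)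
      (by rw [add_sub_cancel, hnr v he.right_mem]) (by rw [add_sub_cancel, hnr w hew.right_mem])
      (by rw [hβγ, add_sub_cancel, norm_neg, hnr y hy]) (fun h => hwv (sub_left_inj.1 h).symm)
      (sub_ne_zero.2 huv.symm) (sub_ne_zero.2 huw.symm) hβ hγ
      (by
        rw [hβγ, sub_ne_zero]
        rintro h
        exact hnu (by rw [← h, neg_neg]; exact hy))
      (by rw [hβγ, Ne, sub_left_inj]; exact hyvw.1)
      (by rw [hβγ, Ne, sub_left_inj]; exact hyvw.2)
    rw [h1 k, hkv, hkw]
    linarith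
  have huv' : u ≠ -v := fun h => hnu (by rw [h, neg_neg]; exact he.right_mem)
  have huw' : u ≠ -w := fun h => hnu (by rw [h, neg_neg]; exact hew.right_mem)
  have hface : face W k = {-v, -w} := by
    have hle : ∀ y ∈ W, ⟪k, y⟫_ℝ ≤ ⟪k, -v⟫_ℝ := fun y hy => by
      by_cases hyvw : -y ∈ ({v, w} : Set E)
      · rcases hyvw with h | h
        · rw [← h, neg_neg]
        · have h : -y = w := h
          rw [← neg_neg y, h, inner_neg_right, inner_neg_right, hkv, hkw]
      · have := hrel y hy hyvw
        rw [inner_neg_right] at this ⊢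
        linarith
    refine Set.ext fun y => ⟨fun hy => ?_, ?_⟩
    · by_contra hc
      have h1 := hrel y hy.1 (fun h => hc (by
        rcases h with h | h
        · exact Or.inl (by rw [← h, neg_neg])
        · have h : -y = w := h
          exact Or.inr (by rw [← h, neg_neg]; rfl)))
      have h2 := hy.2 (-v) hv'.1
      rw [inner_neg_right] at h1 h2
      linarith
    · rintro (rfl | rfl)
      · exact ⟨hv'.1, hle⟩
      · refine ⟨hw'.1, fun y hy => (hle y hy).trans_eq ?_⟩
        rw [inner_neg_right, inner_neg_right, hkv, hkw]
  obtain ⟨y, hy⟩ := face_nonempty hW ⟨x, hx⟩ (-k)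
  have h1 := hy.2 u he.left_mem
  rw [inner_neg_left k u, inner_neg_left k y, neg_le_neg_iff] at h1
  rcases hH.face_neg_subset hT hWT hr (fun h => hwv (neg_inj.1 h).symm) hface he.left_mem huv' huw' hy
    with h | h
  · rw [h, neg_neg] at h1
    linarith
  · have h : y = - -w := h
    rw [h, neg_neg] at h1
    linarith

/-- The bisector of `u v` enters the polygon at the midpoint of `u v` and leaves it inside another
edge `a b`, since it contains no vertex. Both boundary points have the same norm and lie on one line
through the origin, so they are antipodal. -/
lemma SectionCondition.exists_isEdgeOf {W : Set E} (hH : SectionCondition W) (hW : W.Finite)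
    {T : Submodule ℝ E} (hT : Module.finrank ℝ T = 2) (hWT : W ⊆ T) {r : ℝ}
    (hr : ∀ w ∈ W, ‖w‖ = r) {u v x : E} (he : IsEdgeOf W u v)
    (hx : x ∈ W) (hxu : x ≠ u) (hxv : x ≠ v) :
    u + v ≠ 0 ∧ ∃ a b, IsEdgeOf W a b ∧ ∃ s t : ℝ, 0 < s ∧ 0 < t ∧ s + t = 1 ∧
      s • a + t • b = -((1 / 2 : ℝ) • (u + v)) := by
  obtain ⟨huv, g, hg⟩ := id he
  obtain ⟨hH0, hH1⟩ := hH u v he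
  set z := u - v with hz
  have hu : u ∈ face W g := by simp [hg]
  have hv : v ∈ face W g := by simp [hg]
  have hn : ‖v‖ = ‖u‖ := (hr v hv.1).trans (hr u hu.1).symm
  have hz0 : ⟪z, z⟫_ℝ ≠ 0 := fun hc => huv (sub_eq_zero.1 (inner_self_eq_zero.1 hc))
  have hzT : z ∈ T := T.sub_mem (hWT hu.1) (hWT hv.1)
  have hgv : ⟪g, v⟫_ℝ = ⟪g, u⟫_ℝ := face_inner_eq hv hu
  have hgz : ⟪g, z⟫_ℝ = 0 := by rw [hz, inner_sub_right, hgv, sub_self]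
  have hpos := norm_inner_sub_pos hn.symm huv
  rw [← hz] at hpos
  have hxlt : ⟪g, x⟫_ℝ < ⟪g, u⟫_ℝ := by
    refine lt_of_le_of_ne (hu.2 x hx) fun h => ?_
    have := mem_face_of_inner_eq hu hx h.symm
    rw [hg] at this
    rcases this with h | h
    · exact hxu h
    · exact hxv h
  set U : Set E := {w | w ∈ W ∧ 0 < ⟪w, z⟫_ℝ} with hU
  set D : Set E := {w | w ∈ W ∧ ⟪w, z⟫_ℝ < 0} with hD
  have hUf : U.Finite := hW.subset fun _ h => h.1
  have hDf : D.Finite := hW.subset fun _ h => h.1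
  have huU : u ∈ U := ⟨hu.1, hpos.1⟩
  have hvD : v ∈ D := ⟨hv.1, hpos.2⟩
  -- The value of `g` at the point where the segment between `p.1` and `p.2` crosses the bisector;
  -- the edge farthest from `u v` minimizes it.
  set φ : E × E → ℝ := fun p =>
    (⟪p.1, z⟫_ℝ * ⟪g, p.2⟫_ℝ - ⟪p.2, z⟫_ℝ * ⟪g, p.1⟫_ℝ) / (⟪p.1, z⟫_ℝ - ⟪p.2, z⟫_ℝ) with hφ
  obtain ⟨⟨a, b⟩, ⟨ha, hb⟩, hmin⟩ := (hUf.prod hDf).exists_minimalFor φ _ ⟨(u, v), huU, hvD⟩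
  have hmin' : ∀ p ∈ U, ∀ q ∈ D, φ (a, b) ≤ φ (p, q) := fun p hp q hq =>
    (le_total (φ (a, b)) (φ (p, q))).elim id fun h => hmin (j := (p, q)) ⟨hp, hq⟩ h
  simp only at ha hb
  have hab : 0 < ⟪a, z⟫_ℝ - ⟪b, z⟫_ℝ := by linarith [ha.2, hb.2]
  set M := φ (a, b) with hM
  have hMval : M * (⟪a, z⟫_ℝ - ⟪b, z⟫_ℝ) = ⟪a, z⟫_ℝ * ⟪g, b⟫_ℝ - ⟪b, z⟫_ℝ * ⟪g, a⟫_ℝ :=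
    div_mul_cancel₀ _ hab.ne'
  have hMlt : M < ⟪g, u⟫_ℝ := by
    rcases lt_or_gt_of_ne (hH0 x hx) with h | h
    · refine (hmin' u huU x ⟨hx, h⟩).trans_lt ?_
      simp only [hφ]
      rw [div_lt_iff₀ (by linarith [hpos.1])]
      nlinarith [hpos.1]
    · refine (hmin' x ⟨hx, h⟩ v hvD).trans_lt ?_
      simp only [hφ]
      rw [div_lt_iff₀ (by linarith [hpos.2]), hgv]
      nlinarith [hpos.2]
  -- Chosen so that `k = g + l • z` agrees at `a` and `b`. On the bisector, `k` still equals `g`,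
  -- and minimality of the crossing makes the line through `a` and `b` supporting.
  set l := (⟪g, b⟫_ℝ - ⟪g, a⟫_ℝ) / (⟪a, z⟫_ℝ - ⟪b, z⟫_ℝ) with hl
  have hlval : l * (⟪a, z⟫_ℝ - ⟪b, z⟫_ℝ) = ⟪g, b⟫_ℝ - ⟪g, a⟫_ℝ := div_mul_cancel₀ _ hab.ne'
  set k := g + l • z with hk
  have hkval : ∀ y, ⟪k, y⟫_ℝ = ⟪g, y⟫_ℝ + l * ⟪y, z⟫_ℝ := fun y => by
    rw [hk, inner_add_left, inner_smul_left, real_inner_comm y z]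
    rfl
  have hka : ⟪k, a⟫_ℝ = M := by
    rw [hkval]
    refine mul_right_cancel₀ hab.ne' ?_
    linear_combination ⟪a, z⟫_ℝ * hlval - hMval
  have hkb : ⟪k, b⟫_ℝ = M := by
    rw [hkval]
    refine mul_right_cancel₀ hab.ne' ?_
    linear_combination ⟪b, z⟫_ℝ * hlval - hMval
  have hkge : ∀ y ∈ W, M ≤ ⟪k, y⟫_ℝ := fun y hy => by
    rcases lt_or_gt_of_ne (hH0 y hy) with h | h
    · have h1 := hmin' a ha y ⟨hy, h⟩
      simp only [hφ] at h1
      rw [le_div_iff₀ (by linarith [ha.2])] at h1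
      have h2 := hkval y
      have h3 := hkval a
      have h4 : 0 ≤ ⟪a, z⟫_ℝ * (⟪k, y⟫_ℝ - M) := by
        rw [hka] at h3
        rw [h2]
        linear_combination h1 + (⟪y, z⟫_ℝ) * h3
      have := nonneg_of_mul_nonneg_right h4 ha.2
      linarith
    · have h1 := hmin' y ⟨hy, h⟩ b hb
      simp only [hφ] at h1
      rw [le_div_iff₀ (by linarith [hb.2])] at h1
      have h2 := hkval y
      have h3 := hkval b
      have h4 : 0 ≤ (-⟪b, z⟫_ℝ) * (⟪k, y⟫_ℝ - M) := by
        rw [hkb] at h3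
        rw [h2]
        linear_combination h1 - (⟪y, z⟫_ℝ) * h3
      have := nonneg_of_mul_nonneg_right h4 (neg_pos.2 hb.2)
      linarith
  have hsum0 : ⟪u, z⟫_ℝ + ⟪v, z⟫_ℝ = 0 := by
    rw [← inner_add_left]
    exact inner_add_sub_eq_zero hn
  have hkt : 0 < ⟪k, u + v - (2 : ℝ) • a⟫_ℝ := by
    rw [inner_sub_right, inner_smul_right, inner_add_right, hka, hkval, hkval, hgv]
    linear_combination 2 * hMlt - l * hsum0
  have hane : a ≠ b := by
    rintro rfl
    exact lt_asymm ha.2 hb.2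
  have hnr : ∀ x ∈ W, ‖x‖ = ‖a‖ := fun x hx => (hr x hx).trans (hr a ha.1).symm
  have heab : IsEdgeOf W a b := by
    refine isEdgeOf_of_lt (g := -k) hane ha.1 hb.1 ?_ fun w hw hwa hwb => ?_
    · rw [inner_neg_left, inner_neg_left, hka, hkb]
    · rw [inner_neg_left, inner_neg_left, neg_lt_neg_iff, hka]
      refine lt_of_le_of_ne (hkge w hw) fun h => ?_
      rcases eq_or_eq_of_inner_eq hT (k := k)
        (T.sub_mem (T.add_mem (hWT hu.1) (hWT hv.1)) (T.smul_mem _ (hWT ha.1))) hkt.ne'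
        (hWT ha.1) (hWT hb.1) (hWT hw) hane (hnr b hb.1) (hnr w hw) (hkb.trans hka.symm)
        (h.symm.trans hka.symm) with h | h
      · exact hwa h
      · exact hwb h
  set s := -⟪b, z⟫_ℝ / (⟪a, z⟫_ℝ - ⟪b, z⟫_ℝ) with hs
  set t := ⟪a, z⟫_ℝ / (⟪a, z⟫_ℝ - ⟪b, z⟫_ℝ) with ht
  have hspos : 0 < s := div_pos (neg_pos.2 hb.2) hab
  have htpos : 0 < t := div_pos ha.2 hab
  have hst : s + t = 1 := by
    rw [hs, ht, ← add_div, div_eq_one_iff_eq hab.ne']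
    ring
  set q := s • a + t • b with hq
  have hqz : ⟪q, z⟫_ℝ = 0 := by
    rw [hq, inner_add_left, inner_smul_left, inner_smul_left, conj_trivial, conj_trivial, hs, ht]
    field_simp
    ring
  have hgq : ⟪g, q⟫_ℝ = M := by
    have h1 : ⟪k, q⟫_ℝ = M := by
      rw [hq, inner_add_right, inner_smul_right, inner_smul_right, hka, hkb, ← add_mul, hst, one_mul]
    rw [hkval, hqz, mul_zero, add_zero] at h1
    exact h1
  have hqn := hH1 a b heab q ⟨s, t, hspos.le, htpos.le, hst, rfl⟩ hqz
  have huv0 : u + v ≠ 0 := fun h0 => by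
    rw [h0, norm_zero, zero_div, norm_eq_zero] at hqn
    have h1 : ⟪g, u + v⟫_ℝ = 0 := by rw [h0, inner_zero_right]
    rw [inner_add_right, hgv] at h1
    rw [hqn, inner_zero_right] at hgq
    linarith
  refine ⟨huv0, a, b, heab, s, t, hspos, htpos, hst, ?_⟩
  obtain ⟨c, hc⟩ := exists_eq_smul_of_inner_eq_zero hT (k := z) hzT hz0
    (T.add_mem (hWT hu.1) (hWT hv.1)) huv0 (by rw [real_inner_comm]; exact inner_add_sub_eq_zero hn)
    (T.add_mem (T.smul_mem s (hWT ha.1)) (T.smul_mem t (hWT hb.1)))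
    (by rw [real_inner_comm]; exact hqz)
  rw [← hq] at hc
  rw [hc, norm_smul, Real.norm_eq_abs, div_eq_inv_mul] at hqn
  have habs := mul_right_cancel₀ (norm_ne_zero_iff.2 huv0) hqn
  -- The positive sign would make the crossing point the midpoint of `u v`, where `g` is larger than
  -- `M`.
  rcases abs_eq (by norm_num) |>.1 habs with h | h
  · rw [hc, h, inner_smul_right, inner_add_right, hgv] at hgq
    linarith
  · rw [← hq, hc, h, neg_smul, one_div]

/-- Take a longest edge `u' v'` violating the claim and the edge `a b` through the antipode of its
midpoint. If `a b` satisfies the claim, `-a` and `-b` lie in the face `{u', v'}`, so they are `u'`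
and `v'`. Otherwise `a b` is no longer than `u' v'`, which forces both chords to be bisected, and
again `{a, b} = {-u', -v'}`. -/
lemma SectionCondition.neg_mem {W : Set E} (hH : SectionCondition W) (hW : W.Finite)
    {T : Submodule ℝ E} (hT : Module.finrank ℝ T = 2) (hWT : W ⊆ T) {r : ℝ}
    (hr : ∀ w ∈ W, ‖w‖ = r) {u v x : E} (he : IsEdgeOf W u v)
    (hx : x ∈ W) (hxu : x ≠ u) (hxv : x ≠ v) : -u ∈ W ∧ -v ∈ W := by
  have hthird : ∀ a b : E, ∃ y ∈ W, y ≠ a ∧ y ≠ b := fun a b => by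
    have h1 := he.1
    have h2 := he.left_mem
    have h3 := he.right_mem
    by_contra! hc
    grind
  by_contra hbad
  have hfin : {p : E × E | IsEdgeOf W p.1 p.2 ∧ ¬ (-p.1 ∈ W ∧ -p.2 ∈ W)}.Finite :=
    (hW.prod hW).subset fun p hp => ⟨hp.1.left_mem, hp.1.right_mem⟩
  obtain ⟨⟨u', v'⟩, ⟨he', hbad'⟩, hmax⟩ := hfin.exists_maximalFor (fun p => ‖p.1 - p.2‖) _
    ⟨(u, v), he, hbad⟩
  simp only at he' hbad'
  obtain ⟨y, hy, hyu, hyv⟩ := hthird u' v'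
  obtain ⟨h0, a, b, hab, s, t, hs, ht, hst, hq⟩ := hH.exists_isEdgeOf hW hT hWT hr he' hy hyu hyv
  by_cases hg : -a ∈ W ∧ -b ∈ W
  · obtain ⟨huv, g, hgf⟩ := id he'
    have hu : u' ∈ face W g := by simp [hgf]
    have hv : v' ∈ face W g := by simp [hgf]
    have h1 := hu.2 _ hg.1
    have h2 := hu.2 _ hg.2
    have h3 : s * ⟪g, -a⟫_ℝ + t * ⟪g, -b⟫_ℝ = ⟪g, u'⟫_ℝ := by
      have := congrArg (fun y => ⟪g, -y⟫_ℝ) hq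
      simp only [neg_neg, inner_smul_right, inner_add_right, inner_neg_right,
        face_inner_eq hv hu] at this
      rw [inner_neg_right, inner_neg_right]
      linarith
    have h4 : ⟪g, u'⟫_ℝ = ⟪g, -a⟫_ℝ := by
      refine le_antisymm ?_ h1
      by_contra! hc
      obtain rfl : t = 1 - s := by linarith
      nlinarith [mul_pos hs (sub_pos.2 hc), mul_nonneg ht.le (sub_nonneg.2 h2)]
    have h5 : ⟪g, u'⟫_ℝ = ⟪g, -b⟫_ℝ := by
      refine le_antisymm ?_ h2
      by_contra! hc
      obtain rfl : t = 1 - s := by linarith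
      nlinarith [mul_nonneg hs.le (sub_nonneg.2 h1), mul_pos ht (sub_pos.2 hc)]
    have h6 := mem_face_of_inner_eq hu hg.1 h4
    have h7 := mem_face_of_inner_eq hu hg.2 h5
    rw [hgf, Set.mem_insert_iff, Set.mem_singleton_iff] at h6 h7
    have h8 := hab.1
    have h9 := hab.left_mem
    have h10 := hab.right_mem
    apply hbad'
    rcases h6 with h6 | h6 <;> rcases h7 with h7 | h7
    · exact absurd (neg_inj.1 (h6.trans h7.symm)) h8
    · rw [← h6, ← h7, neg_neg, neg_neg]
      exact ⟨h9, h10⟩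
    · rw [← h6, ← h7, neg_neg, neg_neg]
      exact ⟨h10, h9⟩
    · exact absurd (neg_inj.1 (h6.trans h7.symm)) h8
  · have hle : ‖a - b‖ ≤ ‖u' - v'‖ :=
      (le_total ‖a - b‖ ‖u' - v'‖).elim id fun h => hmax (j := (a, b)) ⟨hab, hg⟩ h
    have hle2 : ‖a - b‖ ^ 2 ≤ ‖u' - v'‖ ^ 2 := by gcongr
    have hna := hr a hab.left_mem
    have hnb := hr b hab.right_mem
    have hnu := hr u' he'.left_mem
    have hnv := hr v' he'.right_mem
    have e1 := norm_sub_sq_real a b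
    have e2 := norm_sub_sq_real u' v'
    have e3 := norm_add_sq_real u' v'
    have e4 := norm_add_sq_real (s • a) (t • b)
    rw [hq, norm_neg, norm_smul, norm_smul, norm_smul, inner_smul_left, inner_smul_right, mul_pow,
      mul_pow, mul_pow, Real.norm_eq_abs, Real.norm_eq_abs, Real.norm_eq_abs, sq_abs, sq_abs, sq_abs,
      conj_trivial, hna, hnb] at e4
    rw [hna, hnb] at e1
    rw [hnu, hnv] at e2 e3
    have hpos : 0 < ‖a - b‖ ^ 2 := by
      have := norm_pos_iff.2 (sub_ne_zero.2 hab.1)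
      positivity
    have hts : t = 1 - s := by linarith
    subst hts
    -- The power of the crossing point gives `s * t * ‖a - b‖ ^ 2 = ‖u' - v'‖ ^ 2 / 4`, rewritten as
    -- a sum of nonnegative terms.
    have e5 : (s - 1 / 2) ^ 2 * ‖a - b‖ ^ 2 + (‖u' - v'‖ ^ 2 - ‖a - b‖ ^ 2) / 4 = 0 := by
      linear_combination (-1 / 4 + (s - 1 / 2) ^ 2) * e1 + (1 / 4) * e2 - e4 + (1 / 4) * e3
    have hs2 : (s - 1 / 2) ^ 2 = 0 := by
      have : 0 ≤ (s - 1 / 2) ^ 2 := sq_nonneg _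
      by_contra hc
      have : 0 < (s - 1 / 2) ^ 2 * ‖a - b‖ ^ 2 := mul_pos (lt_of_le_of_ne this (Ne.symm hc)) hpos
      linarith
    have hs1 : s = 1 / 2 := by
      have := pow_eq_zero_iff (two_ne_zero) |>.1 hs2
      linarith
    subst hs1
    have hsum : a + b = -(u' + v') := by
      have := congrArg (fun y => (2 : ℝ) • y) hq
      simp only [smul_add, smul_neg, smul_smul] at this
      norm_num at this
      rw [this, neg_add_rev]
    have e6 := norm_add_sq_real a b
    rw [hsum, norm_neg, hna, hnb] at e6
    have h11 : ⟪u' + v', a⟫_ℝ = ⟪u' + v', -u'⟫_ℝ := by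
      rw [← neg_neg (u' + v'), ← hsum, inner_neg_left, inner_add_left, real_inner_self_eq_norm_sq,
        hna, hsum, neg_neg, inner_neg_right, inner_add_left, real_inner_self_eq_norm_sq, hnu,
        real_inner_comm u' v', real_inner_comm a b]
      linarith
    have h12 : ⟪u' + v', -v'⟫_ℝ = ⟪u' + v', -u'⟫_ℝ := by
      have := inner_add_sub_eq_zero (hnv.trans hnu.symm)
      rw [inner_sub_right] at this
      rw [inner_neg_right, inner_neg_right]
      linarith
    have huT := hWT he'.left_mem
    have hvT := hWT he'.right_mem
    rcases eq_or_eq_of_inner_eq hT (k := u' + v') (T.add_mem huT hvT)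
      (fun h => h0 (inner_self_eq_zero.1 h)) (T.neg_mem huT) (T.neg_mem hvT) (hWT hab.left_mem)
      (fun h => he'.1 (neg_inj.1 h)) (by rw [norm_neg, norm_neg, hnu, hnv])
      (by rw [norm_neg, hna, hnu]) h12 h11 with h | h
    · have hb : b = -v' := by
        rw [h] at hsum
        rw [neg_add] at hsum
        exact add_left_cancel hsum
      exact hbad' ⟨h ▸ hab.left_mem, hb ▸ hab.right_mem⟩
    · have hb : b = -u' := by
        rw [h, neg_add_rev] at hsum
        exact add_left_cancel hsum
      exact hbad' ⟨hb ▸ hab.right_mem, h ▸ hab.left_mem⟩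

/-! ### Passing to faces and recentering them -/

lemma face_image_sub (V : Set E) (c g : E) :
    face ((fun x => x - c) '' V) g = (fun x => x - c) '' face V g := by
  ext w
  constructor
  · rintro ⟨⟨y, hy, rfl⟩, h⟩
    refine ⟨y, ⟨hy, fun x hx => ?_⟩, rfl⟩
    have := h (x - c) ⟨x, hx, rfl⟩
    simpa only [inner_sub_right, sub_le_sub_iff_right] using this
  · rintro ⟨y, ⟨hy, h⟩, rfl⟩
    refine ⟨⟨y, hy, rfl⟩, ?_⟩
    rintro _ ⟨x, hx, rfl⟩
    simpa only [inner_sub_right, sub_le_sub_iff_right] using h x hx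

lemma isEdgeOf_image_sub {V : Set E} {c u v : E} :
    IsEdgeOf ((fun x => x - c) '' V) u v ↔ IsEdgeOf V (u + c) (v + c) := by
  have himg : ∀ g, face ((fun x => x - c) '' V) g = {u, v} ↔ face V g = {u + c, v + c} := fun g => by
    have hinj : Function.Injective fun x : E => x - c := sub_left_injective
    have : ({u, v} : Set E) = (fun x => x - c) '' {u + c, v + c} := by
      simp [Set.image_pair]
    rw [face_image_sub, this, hinj.image_injective.eq_iff]
  simp only [IsEdgeOf, himg, Ne, add_left_inj]

lemma ProjectionCondition.image_sub {V : Set E} (hH : ProjectionCondition V) {c : E}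
    (hc : ∀ x ∈ V, ∀ y ∈ V, ⟪c, x⟫_ℝ = ⟪c, y⟫_ℝ) :
    ProjectionCondition ((fun x => x - c) '' V) := by
  intro u v he k hk hline w hw
  have he' := isEdgeOf_image_sub.1 he
  have hcz : ⟪c, u - v⟫_ℝ = 0 := by
    have := hc _ he'.left_mem _ he'.right_mem
    rw [inner_add_right, inner_add_right] at this
    rw [inner_sub_right]
    linarith
  rw [face_image_sub] at hw hline
  obtain ⟨w, hw, rfl⟩ := hw
  have := hH _ _ he' k (by rwa [add_sub_add_right_eq_sub]) (fun x hx y hy => by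
    rw [add_sub_add_right_eq_sub]
    simpa using hline _ ⟨x, hx, rfl⟩ _ ⟨y, hy, rfl⟩) w hw
  rwa [add_sub_add_right_eq_sub, ← sub_add_cancel w c, inner_add_left, hcz, add_zero] at this

/-- As `⟪c, ·⟫` is constant on `V`, subtracting `c` preserves inner products with edge directions
and changes the squared norms of crossing points and edge midpoints by the same amount. -/
lemma SectionCondition.image_sub {V : Set E} (hH : SectionCondition V) {c : E}
    (hc : ∀ x ∈ V, ∀ y ∈ V, ⟪c, x⟫_ℝ = ⟪c, y⟫_ℝ) :
    SectionCondition ((fun x => x - c) '' V) := by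
  intro u v he
  have he' := isEdgeOf_image_sub.1 he
  have hcz : ⟪c, u - v⟫_ℝ = 0 := by
    have := hc _ he'.left_mem _ he'.right_mem
    rw [inner_add_right, inner_add_right] at this
    rw [inner_sub_right]
    linarith
  obtain ⟨h0, h1⟩ := hH _ _ he'
  rw [add_sub_add_right_eq_sub] at h0 h1
  constructor
  · rintro _ ⟨w, hw, rfl⟩
    rw [inner_sub_left, hcz, sub_zero]
    exact h0 w hw
  · intro a b hab q hq hqz
    have hab' := isEdgeOf_image_sub.1 hab
    have hq' : q + c ∈ segment ℝ (a + c) (b + c) := by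
      obtain ⟨s, t, hs, ht, hst, rfl⟩ := hq
      refine ⟨s, t, hs, ht, hst, ?_⟩
      rw [smul_add, smul_add, add_add_add_comm, ← add_smul, hst, one_smul]
    have h2 := h1 _ _ hab' _ hq' (by rw [inner_add_left, hqz, hcz, add_zero])
    have h3 : ⟪c, q + c⟫_ℝ = ⟪c, u + c⟫_ℝ := by
      obtain ⟨s, t, hs, ht, hst, h⟩ := hq'
      rw [← h, inner_add_right, inner_smul_right, inner_smul_right,
        hc _ hab'.left_mem _ he'.left_mem, hc _ hab'.right_mem _ he'.left_mem, ← add_mul, hst,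
        one_mul]
    have h4 := hc _ he'.left_mem _ he'.right_mem
    have e1 := norm_sub_sq_real (q + c) c
    have e2 := norm_sub_sq_real ((u + c) + (v + c)) ((2 : ℝ) • c)
    have e3 : u + c + (v + c) - (2 : ℝ) • c = u + v := by rw [two_smul]; abel
    rw [e3, norm_smul, inner_smul_right, real_inner_comm, inner_add_right, ← h4, ← h3,
      Real.norm_eq_abs, abs_two] at e2
    rw [add_sub_cancel_right, real_inner_comm, h2] at e1
    have e4 : ‖q‖ ^ 2 = (‖u + v‖ / 2) ^ 2 := by
      linear_combination e1 - (1 / 4) * e2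
    exact (pow_left_inj₀ (norm_nonneg _) (by positivity) two_ne_zero).1 e4

/-- For small `ε`, the face of the face in direction `k` is the face of `V` in direction `g + ε •
k`, which is still orthogonal to the edge. -/
lemma ProjectionCondition.face {V : Set E} (hH : ProjectionCondition V) (hV : V.Finite) (g : E) :
    ProjectionCondition (face V g) := by
  intro u v he k hk hline w hw
  obtain ⟨ε, -, hε⟩ := exists_face_eq_face_face hV g k
  rw [← hε] at hline hw
  refine hH u v (he.of_face hV) (g + ε • k) ?_ hline w hw
  rw [inner_add_left, inner_smul_left, hk, mul_zero, add_zero, inner_sub_right,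
    face_inner_eq he.left_mem he.right_mem, sub_self]

lemma SectionCondition.face {V : Set E} (hH : SectionCondition V) (hV : V.Finite) (g : E) :
    SectionCondition (face V g) := fun u v he =>
  ⟨fun w hw => (hH u v (he.of_face hV)).1 w hw.1,
    fun a b hab => (hH u v (he.of_face hV)).2 a b (hab.of_face hV)⟩

/-- If a two-dimensional face contains a translate of the segment `[-z/2, z/2]` at `p`, it also
contains the translate at the opposite point `q`. -/
lemma mem_of_face_subset_plane [FiniteDimensional ℝ E] {V : Set E} (hV : V.Finite) {r : ℝ}
    (hr : ∀ w ∈ V, ‖w‖ = r) (hH : ProjectionCondition V ∨ SectionCondition V) {p q z k x : E}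
    (hpq : p ≠ q) (hz : z ≠ 0) (hpz : ⟪p, z⟫_ℝ = 0) (hqz : ⟪q, z⟫_ℝ = 0) (hn : ‖p‖ = ‖q‖)
    (h1 : p + (1 / 2 : ℝ) • z ∈ face V k) (h2 : p - (1 / 2 : ℝ) • z ∈ face V k)
    (hx : x ∈ face V k) (hx1 : x ≠ p + (1 / 2 : ℝ) • z) (hx2 : x ≠ p - (1 / 2 : ℝ) • z)
    (hspan : ∀ w ∈ face V k, ∃ s t : ℝ, 0 ≤ t ∧ w = p + s • z + t • (q - p)) :
    q + (1 / 2 : ℝ) • z ∈ V ∧ q - (1 / 2 : ℝ) • z ∈ V := by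
  set d := q - p with hd
  have hd0 : d ≠ 0 := sub_ne_zero.2 hpq.symm
  have hdz : ⟪d, z⟫_ℝ = 0 := by rw [hd, inner_sub_left, hpz, hqz, sub_zero]
  have hdd : 0 < ⟪d, d⟫_ℝ := real_inner_self_pos.2 hd0
  -- The center of the circle cut out by the plane: it is orthogonal to `z` and, because `‖p‖ =
  -- ‖q‖`, also to `q - p`. Reflection in `c` takes `p ± z/2` to `q ∓ z/2`.
  set c := (1 / 2 : ℝ) • (p + q) with hc
  have hcz : ⟪c, z⟫_ℝ = 0 := by
    rw [hc, inner_smul_left, inner_add_left, hpz, hqz, add_zero, mul_zero]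
  have hcd : ⟪c, d⟫_ℝ = 0 := by
    rw [hc, inner_smul_left, hd, add_comm p q, inner_add_sub_eq_zero hn, mul_zero]
  have hcw : ∀ w ∈ face V k, ⟪c, w⟫_ℝ = ⟪c, p⟫_ℝ := fun w hw => by
    obtain ⟨s, t, -, rfl⟩ := hspan w hw
    rw [inner_add_right, inner_add_right, inner_smul_right, inner_smul_right, hcz, hcd, mul_zero,
      mul_zero, add_zero, add_zero]
  set W := (fun y => y - c) '' face V k with hW
  have hWf : W.Finite := (hV.subset (face_subset V k)).image _
  set T := Submodule.span ℝ (Set.range ![z, d]) with hT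
  have hli : LinearIndependent ℝ ![z, d] := linearIndependent_pair_of_inner hz hdz hdd.ne'
  have hTr : Module.finrank ℝ T = 2 := by
    rw [hT, finrank_span_eq_card hli, Fintype.card_fin]
  have hzT : z ∈ T := Submodule.subset_span ⟨0, rfl⟩
  have hdT : d ∈ T := Submodule.subset_span ⟨1, rfl⟩
  have hWT : W ⊆ T := by
    rintro _ ⟨w, hw, rfl⟩
    obtain ⟨s, t, -, rfl⟩ := hspan w hw
    have : p + s • z + t • d - c = s • z + (t - 1 / 2) • d := by
      rw [hc, hd]
      module
    simp only [SetLike.mem_coe, this]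
    exact T.add_mem (T.smul_mem _ hzT) (T.smul_mem _ hdT)
  have hWr : ∀ w ∈ W, ‖w‖ = ‖p + (1 / 2 : ℝ) • z - c‖ := by
    rintro _ ⟨w, hw, rfl⟩
    have e1 := norm_sub_sq_real w c
    have e2 := norm_sub_sq_real (p + (1 / 2 : ℝ) • z) c
    rw [real_inner_comm, hcw _ hw, hr w hw.1] at e1
    rw [real_inner_comm, hcw _ h1, hr _ h1.1] at e2
    exact (pow_left_inj₀ (norm_nonneg _) (norm_nonneg _) two_ne_zero).1 (e1.trans e2.symm)
  have hne : p + (1 / 2 : ℝ) • z ≠ p - (1 / 2 : ℝ) • z := fun h => hz (by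
    have : z = (p + (1 / 2 : ℝ) • z) - (p - (1 / 2 : ℝ) • z) := by module
    rw [this, h, sub_self])
  have he : IsEdgeOf (face V k) (p + (1 / 2 : ℝ) • z) (p - (1 / 2 : ℝ) • z) := by
    have hval : ∀ s t : ℝ, ⟪-d, p + s • z + t • d⟫_ℝ = ⟪-d, p⟫_ℝ - t * ⟪d, d⟫_ℝ := fun s t => by
      rw [inner_add_right, inner_add_right, inner_smul_right, inner_smul_right, inner_neg_left d z,
        inner_neg_left d d, hdz]
      ring
    have hval1 := hval (1 / 2) 0
    have hval2 := hval (-1 / 2) 0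
    rw [zero_smul, add_zero, zero_mul, sub_zero] at hval1 hval2
    rw [neg_div, neg_smul, ← sub_eq_add_neg] at hval2
    refine isEdgeOf_of_lt (g := -d) hne h1 h2 (hval1.trans hval2.symm) fun w hw hw1 hw2 => ?_
    obtain ⟨s, t, ht, rfl⟩ := hspan w hw
    rw [hval, hval1]
    rcases ht.eq_or_lt with rfl | ht
    · exfalso
      rw [zero_smul, add_zero] at hw hw1 hw2
      have e1 := norm_add_sq_real p (s • z)
      have e2 := norm_add_sq_real p ((1 / 2 : ℝ) • z)
      rw [hr _ hw.1, inner_smul_right, hpz, norm_smul, mul_pow, Real.norm_eq_abs, sq_abs] at e1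
      rw [hr _ h1.1, inner_smul_right, hpz, norm_smul, mul_pow, Real.norm_eq_abs, sq_abs] at e2
      have hz2 : ‖z‖ ^ 2 ≠ 0 := pow_ne_zero 2 (norm_ne_zero_iff.2 hz)
      have e3 : s ^ 2 = (1 / 2) ^ 2 := mul_right_cancel₀ hz2 (by linarith)
      rcases sq_eq_sq_iff_eq_or_eq_neg.1 e3 with rfl | rfl
      · exact hw1 rfl
      · rw [neg_smul, ← sub_eq_add_neg] at hw2
        exact hw2 rfl
    · have := mul_pos ht hdd
      linarith
  have he' : IsEdgeOf W (p + (1 / 2 : ℝ) • z - c) (p - (1 / 2 : ℝ) • z - c) := by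
    rw [hW, isEdgeOf_image_sub, sub_add_cancel, sub_add_cancel]
    exact he
  have hxW : x - c ∈ W := ⟨x, hx, rfl⟩
  have hx1' : x - c ≠ p + (1 / 2 : ℝ) • z - c := fun h => hx1 (sub_left_inj.1 h)
  have hx2' : x - c ≠ p - (1 / 2 : ℝ) • z - c := fun h => hx2 (sub_left_inj.1 h)
  have hcc : ∀ x ∈ face V k, ∀ y ∈ face V k, ⟪c, x⟫_ℝ = ⟪c, y⟫_ℝ := fun x hx y hy =>
    (hcw x hx).trans (hcw y hy).symm
  have hneg : -(p + (1 / 2 : ℝ) • z - c) ∈ W ∧ -(p - (1 / 2 : ℝ) • z - c) ∈ W := by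
    rcases hH with hH | hH
    · have hHW : ProjectionCondition W := (hH.face hV k).image_sub hcc
      exact ⟨hHW.neg_mem_left hWf hTr hWT hWr he' hxW hx1' hx2',
        hHW.neg_mem_left hWf hTr hWT hWr he'.symm hxW hx2' hx1'⟩
    · have hHW : SectionCondition W := (hH.face hV k).image_sub hcc
      exact hHW.neg_mem hWf hTr hWT hWr he' hxW hx1' hx2'
  obtain ⟨⟨a, ha, hac⟩, b, hb, hbc⟩ := hneg
  have ha' : a = q - (1 / 2 : ℝ) • z := by
    have : a = (a - c) + c := by abel
    simp only at hac
    rw [this, hac, hc]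
    module
  have hb' : b = q + (1 / 2 : ℝ) • z := by
    have : b = (b - c) + c := by abel
    simp only at hbc
    rw [this, hbc, hc]
    module
  exact ⟨hb' ▸ hb.1, ha' ▸ ha.1⟩

/-! ### Projections along edges -/

/-- The linear projection along `z` onto the orthogonal complement of `z`. -/
noncomputable def projAlong (z : E) : E →ₗ[ℝ] E :=
  LinearMap.id - (‖z‖ ^ 2)⁻¹ • (innerₛₗ ℝ z).smulRight z

lemma projAlong_apply (z x : E) : projAlong z x = x - (⟪x, z⟫_ℝ / ‖z‖ ^ 2) • z := by
  simp only [projAlong, LinearMap.sub_apply, LinearMap.id_apply, LinearMap.smul_apply,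
    LinearMap.smulRight_apply, innerₛₗ_apply_apply, smul_smul, real_inner_comm x z,
    div_eq_inv_mul]

lemma inner_projAlong_self (z x : E) : ⟪projAlong z x, z⟫_ℝ = 0 := by
  by_cases hz : z = 0
  · rw [hz, inner_zero_right]
  · rw [projAlong_apply, inner_sub_left, inner_smul_left, conj_trivial, real_inner_self_eq_norm_sq,
      div_mul_cancel₀ _ (pow_ne_zero 2 (norm_ne_zero_iff.2 hz)), sub_self]

lemma projAlong_eq_self {z x : E} (h : ⟪x, z⟫_ℝ = 0) : projAlong z x = x := by
  rw [projAlong_apply, h, zero_div, zero_smul, sub_zero]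

lemma projAlong_self (z : E) : projAlong z z = 0 := by
  by_cases hz : z = 0
  · rw [hz, map_zero]
  · rw [projAlong_apply, real_inner_self_eq_norm_sq,
      div_self (pow_ne_zero 2 (norm_ne_zero_iff.2 hz)), one_smul, sub_self]

lemma inner_projAlong_right {z k : E} (h : ⟪k, z⟫_ℝ = 0) (x : E) :
    ⟪k, projAlong z x⟫_ℝ = ⟪k, x⟫_ℝ := by
  rw [projAlong_apply, inner_sub_right, inner_smul_right, h, mul_zero, sub_zero]

lemma inner_projAlong_left {z x : E} (h : ⟪x, z⟫_ℝ = 0) (k : E) :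
    ⟪projAlong z k, x⟫_ℝ = ⟪k, x⟫_ℝ := by
  rw [real_inner_comm, inner_projAlong_right h, real_inner_comm]

lemma norm_projAlong_sq {z : E} (hz : z ≠ 0) (x : E) :
    ‖projAlong z x‖ ^ 2 = ‖x‖ ^ 2 - ⟪x, z⟫_ℝ ^ 2 / ‖z‖ ^ 2 := by
  have hz2 : ‖z‖ ^ 2 ≠ 0 := pow_ne_zero 2 (norm_ne_zero_iff.2 hz)
  rw [projAlong_apply, norm_sub_sq_real, inner_smul_right, norm_smul, mul_pow, Real.norm_eq_abs,
    sq_abs]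
  field_simp
  ring

lemma eq_projAlong_add (z x : E) : x = projAlong z x + (⟪x, z⟫_ℝ / ‖z‖ ^ 2) • z := by
  rw [projAlong_apply, sub_add_cancel]

/-- Projections of faces which become points are extreme. -/
lemma projAlong_mem_extremePoints {V : Set E} (hV : V.Finite) {z k w : E} (hk : ⟪k, z⟫_ℝ = 0)
    (hw : w ∈ face V k) (h : ∀ x ∈ face V k, projAlong z x = projAlong z w) :
    projAlong z w ∈ (projAlong z '' convexHull ℝ V).extremePoints ℝ := by
  refine mem_extremePoints_iff_left.2 ⟨⟨w, subset_convexHull ℝ V hw.1, rfl⟩, ?_⟩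
  rintro _ ⟨a, ha, rfl⟩ _ ⟨b, hb, rfl⟩ ⟨s, t, hs, ht, hst, hw'⟩
  have hle : ∀ x ∈ convexHull ℝ V, ⟪k, x⟫_ℝ ≤ ⟪k, w⟫_ℝ := fun x hx =>
    inner_le_of_mem_convexHull hw.2 hx
  have h1 := congrArg (fun y => ⟪k, y⟫_ℝ) hw'
  simp only [inner_add_right, inner_smul_right, inner_projAlong_right hk] at h1
  have h2 : ⟪k, w⟫_ℝ ≤ ⟪k, a⟫_ℝ := by
    by_contra! hc
    obtain rfl : t = 1 - s := by linarith
    nlinarith [mul_pos hs (sub_pos.2 hc), mul_nonneg ht.le (sub_nonneg.2 (hle b hb))]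
  exact convexHull_min (t := {x | projAlong z x = projAlong z w}) h
    ((convex_singleton (projAlong z w)).linear_preimage (projAlong z))
    (mem_convexHull_face hV ha fun y hy => (hw.2 y hy).trans h2)

lemma IsEdgeOf.projAlong_mem_extremePoints {V : Set E} (hV : V.Finite) {u v : E}
    (he : IsEdgeOf V u v) :
    projAlong (u - v) u ∈ (projAlong (u - v) '' convexHull ℝ V).extremePoints ℝ := by
  obtain ⟨-, g, hg⟩ := id he
  have hu : u ∈ face V g := by simp [hg]
  have hv : v ∈ face V g := by simp [hg]
  refine InscribedZonotope.projAlong_mem_extremePoints hV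
    (by rw [inner_sub_right, face_inner_eq hu hv, sub_self]) hu fun x hx => ?_
  rw [hg] at hx
  rcases hx with rfl | rfl
  · rfl
  · rw [eq_comm, ← sub_eq_zero, ← map_sub, projAlong_self]

lemma projAlong_sub_left {u v : E} (h : ‖u‖ = ‖v‖) (huv : u ≠ v) :
    projAlong (u - v) u = (1 / 2 : ℝ) • (u + v) := by
  have hz : ‖u - v‖ ^ 2 ≠ 0 := pow_ne_zero 2 (norm_ne_zero_iff.2 (sub_ne_zero.2 huv))
  rw [projAlong_apply, inner_sub_eq_half_norm_sq h.symm]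
  have : ‖u - v‖ ^ 2 / 2 / ‖u - v‖ ^ 2 = 1 / 2 := by
    rw [div_right_comm, div_self hz]
  rw [this]
  module

lemma convexHull_extremePoints_eq [FiniteDimensional ℝ E] {S : Set E} (hS : IsCompact S)
    (hconv : Convex ℝ S) (hfin : (S.extremePoints ℝ).Finite) :
    convexHull ℝ (S.extremePoints ℝ) = S := by
  have h := closure_convexHull_extremePoints hS hconv
  rwa [(hfin.isCompact_convexHull ℝ).isClosed.closure_eq] at h

lemma norm_add_sq_eq {u v : E} {r : ℝ} (hu : ‖u‖ = r) (hv : ‖v‖ = r) :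
    (‖u + v‖ / 2) ^ 2 = r ^ 2 - ‖u - v‖ ^ 2 / 4 := by
  have e1 := norm_add_sq_real u v
  have e2 := norm_sub_sq_real u v
  rw [hu, hv] at e1 e2
  linear_combination (1 / 4) * e1 + (1 / 4) * e2

/-- The face collapses to an extreme point of the projection. By Pythagoras its norm determines `⟪w,
u - v⟫ ^ 2`, and comparison with the midpoint of `u v` gives the value. -/
lemma projectionCondition_of_extremePoints {V : Set E} (hV : V.Finite) {r : ℝ}
    (hr : ∀ w ∈ V, ‖w‖ = r)
    (hP : ∀ u v, IsEdgeOf V u v → ∀ p ∈ (projAlong (u - v) '' convexHull ℝ V).extremePoints ℝ,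
      ‖p‖ = ‖u + v‖ / 2) : ProjectionCondition V := by
  intro u v he k hk hline w hw
  have hz : u - v ≠ 0 := sub_ne_zero.2 he.1
  have hz2 : 0 < ‖u - v‖ ^ 2 := by
    have := norm_pos_iff.2 hz
    positivity
  have h1 := hP u v he _ (projAlong_mem_extremePoints hV hk hw fun x hx => by
    obtain ⟨t, ht⟩ := hline x hx w hw
    rw [← sub_eq_zero, ← map_sub, ht, map_smul, projAlong_self, smul_zero])
  have h2 := norm_projAlong_sq hz w
  rw [h1, norm_add_sq_eq (hr u he.left_mem) (hr v he.right_mem), hr w hw.1] at h2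
  have h3 : ⟪w, u - v⟫_ℝ ^ 2 = (‖u - v‖ ^ 2 / 2) ^ 2 := by
    field_simp at h2
    linarith
  rw [← abs_of_nonneg (by positivity : 0 ≤ ‖u - v‖ ^ 2 / 2)]
  exact sq_eq_sq_iff_abs_eq_abs _ _ |>.1 h3

lemma half_smul_add_add (u v : E) : (1 / 2 : ℝ) • (u + v) + (1 / 2 : ℝ) • (u - v) = u := by module

lemma half_smul_add_sub (u v : E) : (1 / 2 : ℝ) • (u + v) - (1 / 2 : ℝ) • (u - v) = v := by module

lemma exists_add_smul_of_mem_convexHull_pair {p q x : E} (hx : x ∈ convexHull ℝ {p, q}) :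
    ∃ t : ℝ, 0 ≤ t ∧ x = p + t • (q - p) := by
  rw [convexHull_pair, segment_eq_image'] at hx
  obtain ⟨t, ht, rfl⟩ := hx
  exact ⟨t, ht.1, rfl⟩

theorem hasTranslatedEdges_of_projections [FiniteDimensional ℝ E] {V : Set E} (hV : V.Finite)
    {r : ℝ} (hr : ∀ w ∈ V, ‖w‖ = r)
    (hP : ∀ u v, IsEdgeOf V u v → ∀ p ∈ (projAlong (u - v) '' convexHull ℝ V).extremePoints ℝ,
      ‖p‖ = ‖u + v‖ / 2) : HasTranslatedEdges V := by
  intro u v he k hk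
  have hH := projectionCondition_of_extremePoints hV hr hP
  have hQρ := hP u v he
  have hz : u - v ≠ 0 := sub_ne_zero.2 he.1
  have huv : ‖u‖ = ‖v‖ := (hr u he.left_mem).trans (hr v he.right_mem).symm
  have hmu := projAlong_sub_left huv he.1
  set z := u - v with hzdef
  set S := projAlong z '' convexHull ℝ V with hS
  have hSeq : S = convexHull ℝ (projAlong z '' V) := (projAlong z).image_convexHull V
  have hQV : S.extremePoints ℝ ⊆ projAlong z '' V := by
    rw [hSeq]
    exact extremePoints_convexHull_subset
  have hQf : (S.extremePoints ℝ).Finite := (hV.image _).subset hQV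
  have hKM : convexHull ℝ (S.extremePoints ℝ) = S := by
    refine convexHull_extremePoints_eq ?_ ?_ hQf
    · rw [hSeq]
      exact (hV.image _).isCompact_convexHull ℝ
    · rw [hSeq]
      exact convex_convexHull ℝ _
  have hQz : ∀ p ∈ S.extremePoints ℝ, ⟪p, z⟫_ℝ = 0 := fun p hp => by
    obtain ⟨w, -, rfl⟩ := hQV hp
    exact inner_projAlong_self z w
  have hproj : ∀ w ∈ V, projAlong z w ∈ convexHull ℝ (S.extremePoints ℝ) := fun w hw =>
    hKM.ge ⟨w, subset_convexHull ℝ V hw, rfl⟩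
  have hle : ∀ k p, ⟪k, z⟫_ℝ = 0 → p ∈ face (S.extremePoints ℝ) k →
      ∀ w ∈ V, ⟪k, w⟫_ℝ ≤ ⟪k, p⟫_ℝ := fun k p hk hp w hw => by
    rw [← inner_projAlong_right hk w]
    exact inner_le_of_mem_convexHull hp.2 (hproj w hw)
  have hface : ∀ k p (s : ℝ), ⟪k, z⟫_ℝ = 0 → p ∈ face (S.extremePoints ℝ) k → p + s • z ∈ V →
      p + s • z ∈ face V k := fun k p s hk hp hs => by
    refine ⟨hs, fun w hw => (hle k p hk hp w hw).trans_eq ?_⟩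
    rw [inner_add_right, inner_smul_right, hk, mul_zero, add_zero]
  have hm : (1 / 2 : ℝ) • (u + v) ∈ S.extremePoints ℝ := by
    rw [← hmu]
    exact he.projAlong_mem_extremePoints hV
  -- The good property travels through the edge graph of `S`, starting at the midpoint of `u v`.
  have hgood : ∀ q ∈ S.extremePoints ℝ, q + (1 / 2 : ℝ) • z ∈ V ∧ q - (1 / 2 : ℝ) • z ∈ V := by
    refine forall_of_isEdgeOf hQf hQρ hm ?_ fun p q hpq hp => ?_
    · rw [half_smul_add_add, half_smul_add_sub]
      exact ⟨he.left_mem, he.right_mem⟩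
    · obtain ⟨hne, k₀, hk₀⟩ := id hpq
      have hpz := hQz p hpq.left_mem
      have hqz := hQz q hpq.right_mem
      -- Dropping the `z`-component of `k₀` changes no value on `S` and makes the functional usable
      -- on `V`.
      set k := projAlong z k₀ with hkdef
      have hkz : ⟪k, z⟫_ℝ = 0 := inner_projAlong_self z k₀
      have hk : face (S.extremePoints ℝ) k = {p, q} := by
        rw [← hk₀]
        ext y
        refine and_congr_right fun hy => forall₂_congr fun x hx => ?_
        rw [hkdef, inner_projAlong_left (hQz x hx), inner_projAlong_left (hQz y hy)]
      have hpf : p ∈ face (S.extremePoints ℝ) k := by simp [hk]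
      have hqf : q ∈ face (S.extremePoints ℝ) k := by simp [hk]
      have h1 := hface k p (1 / 2) hkz hpf hp.1
      have h2 := hface k p (-(1 / 2)) hkz hpf (by rw [neg_smul, ← sub_eq_add_neg]; exact hp.2)
      rw [neg_smul, ← sub_eq_add_neg] at h2
      obtain ⟨x, hxV, hxq⟩ := hQV hpq.right_mem
      have hx : x ∈ face V k := by
        refine ⟨hxV, fun w hw => (hle k q hkz hqf w hw).trans_eq ?_⟩
        rw [← hxq, inner_projAlong_right hkz]
      refine mem_of_face_subset_plane hV hr (Or.inl hH) hne hz hpz hqz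
        ((hQρ p hpq.left_mem).trans (hQρ q hpq.right_mem).symm) h1 h2 hx ?_ ?_ ?_
      · rintro rfl
        rw [map_add, map_smul, projAlong_self, smul_zero, add_zero, projAlong_eq_self hpz] at hxq
        exact hne hxq
      · rintro rfl
        rw [map_sub, map_smul, projAlong_self, smul_zero, sub_zero, projAlong_eq_self hpz] at hxq
        exact hne hxq
      · intro w hw
        have h3 : projAlong z w ∈ convexHull ℝ {p, q} := by
          rw [← hk]
          refine mem_convexHull_face hQf (hproj w hw.1) fun y hy => (hpf.2 y hy).trans ?_
          have h4 := hw.2 _ h1.1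
          rw [inner_add_right, inner_smul_right, hkz, mul_zero, add_zero] at h4
          rwa [inner_projAlong_right hkz]
        obtain ⟨t, ht, h5⟩ := exists_add_smul_of_mem_convexHull_pair h3
        refine ⟨⟪w, z⟫_ℝ / ‖z‖ ^ 2, t, ht, ?_⟩
        rw [add_right_comm, ← h5]
        exact eq_projAlong_add z w
  obtain ⟨p, hp⟩ := face_nonempty hQf ⟨_, hm⟩ k
  obtain ⟨h1, h2⟩ := hgood p hp.1
  have h3 := hface k p (1 / 2) hk hp h1
  have h4 := hface k p (-(1 / 2)) hk hp (by rw [neg_smul, ← sub_eq_add_neg]; exact h2)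
  refine ⟨_, h4, ?_⟩
  convert h3 using 1
  module

/-! ### Sections by bisectors -/

/-- Edges crossing the hyperplane orthogonal to `z` meet it in extreme points of the section. -/
lemma mem_extremePoints_section {V : Set E} (hV : V.Finite) {a b q z : E} (he : IsEdgeOf V a b)
    (ha : ⟪a, z⟫_ℝ ≠ 0) (hq : q ∈ segment ℝ a b) (hqz : ⟪q, z⟫_ℝ = 0) :
    q ∈ (convexHull ℝ V ∩ {x | ⟪x, z⟫_ℝ = 0}).extremePoints ℝ := by
  obtain ⟨-, g, hg⟩ := id he
  have haf : a ∈ face V g := by simp [hg]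
  have hbf : b ∈ face V g := by simp [hg]
  have hqV : q ∈ convexHull ℝ V :=
    (convex_convexHull ℝ V).segment_subset (subset_convexHull ℝ V haf.1)
      (subset_convexHull ℝ V hbf.1) hq
  have hgq : ⟪g, q⟫_ℝ = ⟪g, a⟫_ℝ := by
    obtain ⟨s, t, -, -, hst, rfl⟩ := hq
    rw [inner_add_right, inner_smul_right, inner_smul_right, face_inner_eq hbf haf, ← add_mul, hst,
      one_mul]
  refine mem_extremePoints_iff_left.2 ⟨⟨hqV, hqz⟩, ?_⟩
  rintro x ⟨hx, hxz⟩ y ⟨hy, -⟩ ⟨s, t, hs, ht, hst, hxy⟩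
  have hle : ∀ x ∈ convexHull ℝ V, ⟪g, x⟫_ℝ ≤ ⟪g, a⟫_ℝ := fun x hx =>
    inner_le_of_mem_convexHull haf.2 hx
  rw [← hxy, inner_add_right, inner_smul_right, inner_smul_right] at hgq
  have h2 : ⟪g, a⟫_ℝ ≤ ⟪g, x⟫_ℝ := by
    by_contra! hc
    obtain rfl : t = 1 - s := by linarith
    nlinarith [mul_pos hs (sub_pos.2 hc), mul_nonneg ht.le (sub_nonneg.2 (hle y hy))]
  have h3 := mem_convexHull_face hV hx fun w hw => (haf.2 w hw).trans h2
  rw [hg] at h3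
  rw [← convexHull_pair] at hq
  obtain ⟨t₁, -, rfl⟩ := exists_add_smul_of_mem_convexHull_pair h3
  obtain ⟨t₂, -, rfl⟩ := exists_add_smul_of_mem_convexHull_pair hq
  have hxz : ⟪a + t₁ • (b - a), z⟫_ℝ = 0 := hxz
  rw [inner_add_left, inner_smul_left, conj_trivial] at hxz hqz
  have h4 : ⟪b - a, z⟫_ℝ ≠ 0 := fun h => by
    rw [h, mul_zero, add_zero] at hqz
    exact ha hqz
  have h5 : t₁ = t₂ := mul_right_cancel₀ h4 (by linarith)
  rw [h5]

lemma mem_extremePoints_convexHull {V : Set E} {r : ℝ} (hV : V.Finite) (hr : ∀ w ∈ V, ‖w‖ = r)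
    {w : E} (hw : w ∈ V) : w ∈ (convexHull ℝ V).extremePoints ℝ := by
  have h := projAlong_mem_extremePoints (z := 0) (k := w) hV (inner_zero_right w) (w := w)
    ⟨hw, fun x hx => ?_⟩ fun x hx => ?_
  · simpa [projAlong_apply] using h
  · by_cases hxw : w = x
    · rw [hxw]
    · exact (inner_lt_of_norm_eq ((hr w hw).trans (hr x hx).symm) hxw).le
  · by_contra hne
    have hxw : w ≠ x := by
      rintro rfl
      exact hne rfl
    exact absurd (hx.2 w hw) (not_le.2 (inner_lt_of_norm_eq ((hr w hw).trans (hr x hx.1).symm) hxw))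

/-- A vertex on the bisector would be an extreme point of the section with norm `r`, which exceeds
the norm of the midpoint of `u v`. -/
lemma sectionCondition_of_extremePoints {V : Set E} (hV : V.Finite) {r : ℝ}
    (hr : ∀ w ∈ V, ‖w‖ = r)
    (hP : ∀ u v, IsEdgeOf V u v →
      ∀ p ∈ (convexHull ℝ V ∩ {x | ⟪x, u - v⟫_ℝ = 0}).extremePoints ℝ, ‖p‖ = ‖u + v‖ / 2) :
    SectionCondition V := by
  intro u v he
  have h0 : ∀ w ∈ V, ⟪w, u - v⟫_ℝ ≠ 0 := fun w hw hwz => by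
    have hw' := mem_extremePoints_convexHull hV hr hw
    have h1 := hP u v he w ⟨⟨hw'.1, hwz⟩, fun x hx y hy h => hw'.2 hx.1 hy.1 h⟩
    have h2 := norm_add_sq_eq (hr u he.left_mem) (hr v he.right_mem)
    rw [← h1, hr w hw] at h2
    have : 0 < ‖u - v‖ ^ 2 := by
      have := norm_pos_iff.2 (sub_ne_zero.2 he.1)
      positivity
    linarith
  exact ⟨h0, fun a b hab q hq hqz =>
    hP u v he q (mem_extremePoints_section hV hab (h0 a hab.left_mem) hq hqz)⟩

/-- The point where the line through `a` and `b` meets the hyperplane orthogonal to `z`. -/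
noncomputable def crossing (z a b : E) : E :=
  (⟪a, z⟫_ℝ - ⟪b, z⟫_ℝ)⁻¹ • (⟪a, z⟫_ℝ • b - ⟪b, z⟫_ℝ • a)

/-- The section of a polytope with a hyperplane that avoids the vertices is the convex hull of the
points where segments between vertices cross it. -/
lemma section_subset_convexHull_crossing [FiniteDimensional ℝ E] {V : Set E} (hV : V.Finite) {z : E}
    (h0 : ∀ w ∈ V, ⟪w, z⟫_ℝ ≠ 0) {u : E} (hu : u ∈ V) (huz : 0 < ⟪u, z⟫_ℝ) :
    convexHull ℝ V ∩ {x | ⟪x, z⟫_ℝ = 0} ⊆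
      convexHull ℝ ((fun p : E × E => crossing z p.1 p.2) ''
        {p | (p.1 ∈ V ∧ 0 < ⟪p.1, z⟫_ℝ) ∧ p.2 ∈ V ∧ ⟪p.2, z⟫_ℝ < 0}) := by
  rintro x ⟨hx, hxz⟩
  by_contra hxX
  set X := (fun p : E × E => crossing z p.1 p.2) ''
    {p | (p.1 ∈ V ∧ 0 < ⟪p.1, z⟫_ℝ) ∧ p.2 ∈ V ∧ ⟪p.2, z⟫_ℝ < 0} with hX
  have hXf : X.Finite := ((hV.prod hV).subset fun p hp => ⟨hp.1.1, hp.2.1⟩).image _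
  obtain ⟨f, M, hfM, hMx⟩ := geometric_hahn_banach_closed_point (convex_convexHull ℝ X)
    (hXf.isCompact_convexHull ℝ).isClosed hxX
  set g := (InnerProductSpace.toDual ℝ E).symm f
  have hfg : ∀ y, f y = ⟪g, y⟫_ℝ := fun y =>
    (InnerProductSpace.toDual_symm_apply (x := y) (y := f)).symm
  have hcr : ∀ a ∈ V, ∀ b ∈ V, 0 < ⟪a, z⟫_ℝ → ⟪b, z⟫_ℝ < 0 →
      ⟪a, z⟫_ℝ * ⟪g, b⟫_ℝ - ⟪b, z⟫_ℝ * ⟪g, a⟫_ℝ ≤ M * (⟪a, z⟫_ℝ - ⟪b, z⟫_ℝ) := fun a ha b hb hpa hpb => by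
    have h1 : f (crossing z a b) ≤ M := (hfM _ (subset_convexHull ℝ X ⟨(a, b), ⟨⟨ha, hpa⟩, hb, hpb⟩, rfl⟩)).le
    have h2 : 0 < ⟪a, z⟫_ℝ - ⟪b, z⟫_ℝ := by linarith
    rw [hfg, crossing, inner_smul_right, inner_sub_right, inner_smul_right, inner_smul_right,
      ← div_eq_inv_mul, div_le_iff₀ h2] at h1
    exact h1
  -- The largest multiple of `z` that may be added to `g` while keeping the vertices with `⟪a, z⟫ >
  -- 0` below `M`. The crossing inequality then handles those with negative inner product.
  obtain ⟨a, ⟨ha, hpa⟩, hmin⟩ := (hV.subset (Set.sep_subset V fun a => 0 < ⟪a, z⟫_ℝ)).exists_minimalFor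
    (fun a => (M - ⟪g, a⟫_ℝ) / ⟪a, z⟫_ℝ) _ ⟨u, hu, huz⟩
  set l := (M - ⟪g, a⟫_ℝ) / ⟪a, z⟫_ℝ with hl
  have hla : l * ⟪a, z⟫_ℝ = M - ⟪g, a⟫_ℝ := div_mul_cancel₀ _ hpa.ne'
  have hle : ∀ y ∈ V, ⟪g + l • z, y⟫_ℝ ≤ M := fun y hy => by
    rw [inner_add_left, inner_smul_left, conj_trivial, real_inner_comm y z]
    rcases lt_or_gt_of_ne (h0 y hy) with h | h
    · have h1 := hcr a ha y hy hpa h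
      have h2 : 0 ≤ ⟪a, z⟫_ℝ * (M - (⟪g, y⟫_ℝ + l * ⟪y, z⟫_ℝ)) := by
        linear_combination h1 + ⟪y, z⟫_ℝ * hla
      linarith [nonneg_of_mul_nonneg_right h2 hpa]
    · have h1 : l ≤ (M - ⟪g, y⟫_ℝ) / ⟪y, z⟫_ℝ :=
        (le_total l ((M - ⟪g, y⟫_ℝ) / ⟪y, z⟫_ℝ)).elim id fun h' => hmin (j := y) ⟨hy, h⟩ h'
      rw [le_div_iff₀ h] at h1
      linarith
  have h1 := inner_le_of_mem_convexHull hle hx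
  have hxz : ⟪x, z⟫_ℝ = 0 := hxz
  rw [inner_add_left, inner_smul_left, real_inner_comm x z, hxz, mul_zero, add_zero] at h1
  rw [hfg] at hMx
  linarith

lemma crossing_mem_section {V : Set E} {z a b : E} (ha : a ∈ V) (hb : b ∈ V) (haz : 0 < ⟪a, z⟫_ℝ)
    (hbz : ⟪b, z⟫_ℝ < 0) : crossing z a b ∈ convexHull ℝ V ∩ {x | ⟪x, z⟫_ℝ = 0} := by
  have h : 0 < ⟪a, z⟫_ℝ - ⟪b, z⟫_ℝ := by linarith
  constructor
  · have h1 := convex_convexHull ℝ V (subset_convexHull ℝ V ha) (subset_convexHull ℝ V hb)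
      (div_nonneg (neg_nonneg.2 hbz.le) h.le) (div_nonneg haz.le h.le)
      (by rw [← add_div, div_eq_one_iff_eq h.ne']; ring)
    have h2 : crossing z a b = (-⟪b, z⟫_ℝ / (⟪a, z⟫_ℝ - ⟪b, z⟫_ℝ)) • a +
        (⟪a, z⟫_ℝ / (⟪a, z⟫_ℝ - ⟪b, z⟫_ℝ)) • b := by
      simp only [crossing]
      module
    rwa [h2]
  · simp only [Set.mem_ofPred_eq, crossing, inner_smul_left, inner_sub_left, conj_trivial]
    ring

theorem hasTranslatedEdges_of_sections [FiniteDimensional ℝ E] {V : Set E} (hV : V.Finite)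
    {r : ℝ} (hr : ∀ w ∈ V, ‖w‖ = r)
    (hP : ∀ u v, IsEdgeOf V u v →
      ∀ p ∈ (convexHull ℝ V ∩ {x | ⟪x, u - v⟫_ℝ = 0}).extremePoints ℝ, ‖p‖ = ‖u + v‖ / 2) :
    HasTranslatedEdges V := by
  intro u v he k hk
  have hH := sectionCondition_of_extremePoints hV hr hP
  have h0 := (hH u v he).1
  have hQρ := hP u v he
  have hz : u - v ≠ 0 := sub_ne_zero.2 he.1
  have huv : ‖u‖ = ‖v‖ := (hr u he.left_mem).trans (hr v he.right_mem).symm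
  have hpos := norm_inner_sub_pos huv he.1
  have hmz : ⟪(1 / 2 : ℝ) • (u + v), u - v⟫_ℝ = 0 := by
    rw [inner_smul_left, inner_add_sub_eq_zero huv.symm, mul_zero]
  set z := u - v with hzdef
  set S := convexHull ℝ V ∩ {x | ⟪x, z⟫_ℝ = 0} with hS
  have hzz : 0 < ⟪z, z⟫_ℝ := real_inner_self_pos.2 hz
  have hlin : IsLinearMap ℝ fun x : E => ⟪x, z⟫_ℝ :=
    ⟨fun x y => inner_add_left x y z, fun c x => real_inner_smul_left x z c⟩
  have hSconv : Convex ℝ S := (convex_convexHull ℝ V).inter (convex_hyperplane hlin 0)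
  have hScpt : IsCompact S := (hV.isCompact_convexHull ℝ).inter_right
    (isClosed_eq (by fun_prop) continuous_const)
  have hSX : S = convexHull ℝ ((fun p : E × E => crossing z p.1 p.2) ''
      {p | (p.1 ∈ V ∧ 0 < ⟪p.1, z⟫_ℝ) ∧ p.2 ∈ V ∧ ⟪p.2, z⟫_ℝ < 0}) := by
    refine (section_subset_convexHull_crossing hV h0 he.left_mem
      hpos.1).antisymm (convexHull_min ?_ hSconv)
    rintro _ ⟨p, ⟨⟨ha, ha'⟩, hb, hb'⟩, rfl⟩
    exact crossing_mem_section ha hb ha' hb'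
  have hQf : (S.extremePoints ℝ).Finite := by
    rw [hSX]
    exact (((hV.prod hV).subset fun p hp => ⟨hp.1.1, hp.2.1⟩).image _).subset
      extremePoints_convexHull_subset
  have hKM : convexHull ℝ (S.extremePoints ℝ) = S := convexHull_extremePoints_eq hScpt hSconv hQf
  have hQz : ∀ p ∈ S.extremePoints ℝ, ⟪p, z⟫_ℝ = 0 := fun p hp => hp.1.2
  have hm : (1 / 2 : ℝ) • (u + v) ∈ S.extremePoints ℝ :=
    mem_extremePoints_section hV he (h0 u he.left_mem)
      ⟨1 / 2, 1 / 2, by norm_num, by norm_num, by norm_num, by rw [smul_add]⟩ hmz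
  -- One of `p ± z/2` lies on the other side of the hyperplane from `w`, so the segment joining it
  -- to `w` meets `S`. Hence a bound for `k ⟂ z` on `S`, attained at a good `p`, extends to all of
  -- `V`.
  have hcross : ∀ p ∈ S.extremePoints ℝ, p + (1 / 2 : ℝ) • z ∈ V ∧ p - (1 / 2 : ℝ) • z ∈ V →
      ∀ w ∈ V, ∃ s α β : ℝ, 0 < α ∧ 0 < β ∧ α + β = 1 ∧ α • w + β • (p + s • z) ∈ S :=
    fun p hp hG w hw => by
      have hpz := hQz p hp
      have hval : ∀ s : ℝ, ⟪p + s • z, z⟫_ℝ = s * ⟪z, z⟫_ℝ := fun s => by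
        rw [inner_add_left, inner_smul_left, hpz, zero_add, conj_trivial]
      have key : ∀ s : ℝ, p + s • z ∈ V → ⟪w, z⟫_ℝ * s < 0 →
          ∃ s α β : ℝ, 0 < α ∧ 0 < β ∧ α + β = 1 ∧ α • w + β • (p + s • z) ∈ S := fun s hs hws => by
        have hne : ⟪w, z⟫_ℝ ≠ 0 := fun h => by rw [h, zero_mul] at hws; exact lt_irrefl _ hws
        set A := ⟪w, z⟫_ℝ ^ 2 with hA
        set B := -(⟪w, z⟫_ℝ * s) * ⟪z, z⟫_ℝ with hB
        have hA0 : 0 < A := by positivity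
        have hB0 : 0 < B := mul_pos (neg_pos.2 hws) hzz
        refine ⟨s, B / (A + B), A / (A + B), by positivity, by positivity, ?_, ?_, ?_⟩
        · rw [← add_div, add_comm B, div_self (by positivity)]
        · exact convex_convexHull ℝ V (subset_convexHull ℝ V hw) (subset_convexHull ℝ V hs)
            (by positivity) (by positivity)
            (by rw [← add_div, add_comm B, div_self (by positivity)])
        · simp only [Set.mem_ofPred_eq]
          rw [inner_add_left, inner_smul_left, inner_smul_left, hval, conj_trivial, conj_trivial]
          rw [hA, hB]
          ring
      rcases lt_or_gt_of_ne (h0 w hw) with h | h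
      · exact key (1 / 2) hG.1 (by linarith)
      · exact key (-(1 / 2)) (by rw [neg_smul, ← sub_eq_add_neg]; exact hG.2) (by linarith)
  have hval : ∀ k p (s : ℝ), ⟪k, z⟫_ℝ = 0 → ⟪k, p + s • z⟫_ℝ = ⟪k, p⟫_ℝ := fun k p s hk => by
    rw [inner_add_right, inner_smul_right, hk, mul_zero, add_zero]
  have hSle : ∀ k p, p ∈ face (S.extremePoints ℝ) k → ∀ x ∈ S, ⟪k, x⟫_ℝ ≤ ⟪k, p⟫_ℝ :=
    fun k p hp x hx => inner_le_of_mem_convexHull hp.2 (hKM.ge hx)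
  have hle : ∀ k p, ⟪k, z⟫_ℝ = 0 → p ∈ face (S.extremePoints ℝ) k →
      p + (1 / 2 : ℝ) • z ∈ V ∧ p - (1 / 2 : ℝ) • z ∈ V → ∀ w ∈ V, ⟪k, w⟫_ℝ ≤ ⟪k, p⟫_ℝ :=
    fun k p hk hp hG w hw => by
      obtain ⟨s, α, β, hα, hβ, hαβ, hmem⟩ := hcross p hp.1 hG w hw
      have h1 := hSle k p hp _ hmem
      rw [inner_add_right, inner_smul_right, inner_smul_right, hval k p s hk] at h1
      obtain rfl : β = 1 - α := by linarith
      by_contra! hc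
      nlinarith
  have hface : ∀ k p, ⟪k, z⟫_ℝ = 0 → p ∈ face (S.extremePoints ℝ) k →
      p + (1 / 2 : ℝ) • z ∈ V ∧ p - (1 / 2 : ℝ) • z ∈ V →
      p + (1 / 2 : ℝ) • z ∈ face V k ∧ p - (1 / 2 : ℝ) • z ∈ face V k := fun k p hk hp hG => by
    refine ⟨⟨hG.1, fun w hw => (hle k p hk hp hG w hw).trans_eq (hval k p _ hk).symm⟩,
      hG.2, fun w hw => (hle k p hk hp hG w hw).trans_eq ?_⟩
    rw [sub_eq_add_neg, ← neg_smul, hval k p _ hk]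
  have hgood : ∀ q ∈ S.extremePoints ℝ, q + (1 / 2 : ℝ) • z ∈ V ∧ q - (1 / 2 : ℝ) • z ∈ V := by
    refine forall_of_isEdgeOf hQf hQρ hm ?_ fun p q hpq hG => ?_
    · rw [half_smul_add_add, half_smul_add_sub]
      exact ⟨he.left_mem, he.right_mem⟩
    · obtain ⟨hne, k₀, hk₀⟩ := id hpq
      have hpz := hQz p hpq.left_mem
      have hqz := hQz q hpq.right_mem
      set k := projAlong z k₀ with hkdef
      have hkz : ⟪k, z⟫_ℝ = 0 := inner_projAlong_self z k₀
      have hk : face (S.extremePoints ℝ) k = {p, q} := by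
        rw [← hk₀]
        ext y
        refine and_congr_right fun hy => forall₂_congr fun x hx => ?_
        rw [hkdef, inner_projAlong_left (hQz x hx), inner_projAlong_left (hQz y hy)]
      have hpf : p ∈ face (S.extremePoints ℝ) k := by simp [hk]
      have hqf : q ∈ face (S.extremePoints ℝ) k := by simp [hk]
      obtain ⟨h1, h2⟩ := hface k p hkz hpf hG
      have hqW : q ∈ convexHull ℝ (face V k) :=
        mem_convexHull_face hV hqf.1.1.1 fun w hw =>
          (hle k p hkz hpf hG w hw).trans_eq (face_inner_eq hpf hqf)
      obtain ⟨x, hx, hx1, hx2⟩ : ∃ x ∈ face V k, x ≠ p + (1 / 2 : ℝ) • z ∧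
          x ≠ p - (1 / 2 : ℝ) • z := by
        by_contra! hc
        have h3 : projAlong z q = p := by
          refine convexHull_min (t := {x | projAlong z x = p}) (fun x hx => ?_)
            ((convex_singleton p).linear_preimage (projAlong z)) hqW
          by_cases hx1 : x = p + (1 / 2 : ℝ) • z
          · simp only [Set.mem_ofPred_eq]
            rw [hx1, map_add, map_smul, projAlong_self, smul_zero, add_zero, projAlong_eq_self hpz]
          · simp only [Set.mem_ofPred_eq]
            rw [hc x hx hx1, map_sub, map_smul, projAlong_self, smul_zero, sub_zero,
              projAlong_eq_self hpz]
        rw [projAlong_eq_self hqz] at h3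
        exact hne h3.symm
      refine mem_of_face_subset_plane hV hr (Or.inr hH) hne hz hpz hqz
        ((hQρ p hpq.left_mem).trans (hQρ q hpq.right_mem).symm) h1 h2 hx hx1 hx2 fun w hw => ?_
      obtain ⟨s, α, β, hα, hβ, hαβ, hmem⟩ := hcross p hpq.left_mem hG w hw.1
      have hwp : ⟪k, w⟫_ℝ = ⟪k, p⟫_ℝ := by
        rw [face_inner_eq hw h1, hval k p _ hkz]
      have h3 : α • w + β • (p + s • z) ∈ convexHull ℝ {p, q} := by
        rw [← hk]
        refine mem_convexHull_face hQf (hKM.ge hmem) fun y hy => (hpf.2 y hy).trans_eq ?_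
        rw [inner_add_right, inner_smul_right, inner_smul_right, hval k p s hkz, hwp, ← add_mul,
          hαβ, one_mul]
      obtain ⟨t, ht, h4⟩ := exists_add_smul_of_mem_convexHull_pair h3
      -- Obtained by solving `α • w + β • (p + s • z) = p + t • (q - p)` for `w`.
      refine ⟨-(β * s) / α, t / α, by positivity, ?_⟩
      have h5 : w = α⁻¹ • (α • w + β • (p + s • z) - β • (p + s • z)) := by
        rw [add_sub_cancel_right, smul_smul, inv_mul_cancel₀ hα.ne', one_smul]
      rw [h5, h4]
      have h6 : p + t • (q - p) - β • (p + s • z) =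
          α • p - (β * s) • z + t • (q - p) := by
        obtain rfl : α = 1 - β := by linarith
        module
      rw [h6, smul_add, smul_sub, smul_smul, smul_smul, smul_smul, inv_mul_cancel₀ hα.ne', one_smul,
        neg_div, neg_smul, ← sub_eq_add_neg, div_eq_inv_mul, div_eq_inv_mul]
  obtain ⟨p, hp⟩ := face_nonempty hQf ⟨_, hm⟩ k
  obtain ⟨h1, h2⟩ := hface k p hk hp (hgood p hp.1)
  refine ⟨_, h2, ?_⟩
  convert h1 using 1
  module

/-! ### Inscribed zonotopes: projection equals section -/

lemma mem_segment_neg_iff {x y : E} : x ∈ segment ℝ (-y) y ↔ ∃ s : ℝ, |s| ≤ 1 ∧ x = s • y := by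
  constructor
  · rintro ⟨a, b, ha, hb, hab, rfl⟩
    exact ⟨b - a, abs_le.2 ⟨by linarith, by linarith⟩, by rw [smul_neg, sub_smul]; abel⟩
  · rintro ⟨s, hs, rfl⟩
    exact smul_mem_segment_neg hs y

lemma mem_zonotope_iff {n : ℕ} {t x : E} {z : Fin n → E} :
    x ∈ ({t} : Set E) + ∑ i, segment ℝ (-(z i)) (z i) ↔
      ∃ l : Fin n → ℝ, (∀ i, |l i| ≤ 1) ∧ x = t + ∑ i, l i • z i := by
  constructor
  · intro hx
    obtain ⟨_, rfl, y, hy, rfl⟩ := Set.mem_add.1 hx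
    obtain ⟨g, hg, rfl⟩ := (Set.mem_fintype_sum _ _).1 hy
    choose l hl hgl using fun i => mem_segment_neg_iff.1 (hg i)
    exact ⟨l, hl, by simp only [← hgl]⟩
  · rintro ⟨l, hl, rfl⟩
    exact Set.add_mem_add rfl (Set.finsetSum_mem_finsetSum _ _ _ fun i _ =>
      smul_mem_segment_neg (hl i) _)

lemma IsZonotope.image_add {P : Set E} (h : IsZonotope P) (c : E) :
    IsZonotope ((fun x => x + c) '' P) := by
  obtain ⟨t, n, z, rfl⟩ := h
  refine ⟨t + c, n, z, ?_⟩
  ext x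
  simp only [Set.mem_image, mem_zonotope_iff]
  constructor
  · rintro ⟨_, ⟨l, hl, rfl⟩, rfl⟩
    exact ⟨l, hl, by abel⟩
  · rintro ⟨l, hl, rfl⟩
    exact ⟨_, ⟨l, hl, rfl⟩, by abel⟩

/-- An extreme point of a projected zonotope determines the coefficients of all generators that are
not collapsed by the projection. -/
lemma coeff_eq_of_mem_extremePoints {n : ℕ} {t p : E} {z : Fin n → E} {Z : Set E}
    (hZ : Z = {t} + ∑ i, segment ℝ (-(z i)) (z i)) (L : E →ₗ[ℝ] E)
    (hp : p ∈ (L '' Z).extremePoints ℝ) {l m : Fin n → ℝ} (hl : ∀ i, |l i| ≤ 1)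
    (hm : ∀ i, |m i| ≤ 1) (hlp : L (t + ∑ i, l i • z i) = p) (hmp : L (t + ∑ i, m i • z i) = p)
    {i : Fin n} (hi : L (z i) ≠ 0) : l i = m i := by
  -- At the average of `l` and `m`, the coefficient `i` can move by `(l i - m i) / 2` either way,
  -- which would make `p` the midpoint of two points of the image.
  have hpt : ∀ δ : ℝ, |(l i + m i) / 2 + δ| ≤ 1 → p + δ • L (z i) ∈ L '' Z := fun δ hδ => by
    refine ⟨t + ∑ j, ((l j + m j) / 2 + (Pi.single i δ : Fin n → ℝ) j) • z j, ?_, ?_⟩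
    · rw [hZ, mem_zonotope_iff]
      refine ⟨_, fun j => ?_, rfl⟩
      by_cases hj : j = i
      · rw [hj, Pi.single_eq_same]
        exact hδ
      · rw [Pi.single_eq_of_ne hj, add_zero]
        have h1 := abs_le.1 (hl j)
        have h2 := abs_le.1 (hm j)
        exact abs_le.2 ⟨by linarith, by linarith⟩
    · have h1 : ∑ j, (Pi.single i δ : Fin n → ℝ) j • z j = δ • z i := by
        rw [Finset.sum_eq_single i (fun j _ hj => by rw [Pi.single_eq_of_ne hj, zero_smul])
          (fun h => absurd (Finset.mem_univ i) h), Pi.single_eq_same]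
      have h2 : t + ∑ j, ((l j + m j) / 2 + (Pi.single i δ : Fin n → ℝ) j) • z j =
          (1 / 2 : ℝ) • (t + ∑ j, l j • z j) + (1 / 2 : ℝ) • (t + ∑ j, m j • z j) + δ • z i := by
        simp only [add_smul, Finset.sum_add_distrib, h1, div_eq_inv_mul, mul_smul,
          ← Finset.smul_sum]
        module
      rw [h2, map_add, map_add, map_smul, map_smul, map_smul, hlp, hmp, ← add_smul]
      norm_num
  have h1 := hpt ((l i - m i) / 2) (by
    rw [show (l i + m i) / 2 + (l i - m i) / 2 = l i by ring]
    exact hl i)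
  have h2 := hpt (-((l i - m i) / 2)) (by
    rw [show (l i + m i) / 2 + -((l i - m i) / 2) = m i by ring]
    exact hm i)
  have h3 := hp.2 h1 h2 ⟨1 / 2, 1 / 2, by norm_num, by norm_num, by norm_num, by module⟩
  have h4 := (smul_eq_zero.1 (add_eq_left.1 h3)).resolve_right hi
  linarith

/-- The fibre over an extreme point of a zonotope projected along an edge is a translate of a fixed
segment, whose endpoints are vertices. -/
theorem norm_eq_of_isZonotope {V : Set E} (hV : V.Finite) {r : ℝ} (hr : ∀ w ∈ V, ‖w‖ = r)
    (hZ : IsZonotope (convexHull ℝ V)) {u v : E} (he : IsEdgeOf V u v) :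
    ∃ ρ : ℝ, ∀ p ∈ (projAlong (u - v) '' convexHull ℝ V).extremePoints ℝ,
      ‖p‖ = ρ ∧ p ∈ convexHull ℝ V := by
  classical
  obtain ⟨t, n, y, hy⟩ := hZ
  have hz : u - v ≠ 0 := sub_ne_zero.2 he.1
  have hm := he.projAlong_mem_extremePoints hV
  have hmem : ∀ {x}, x ∈ convexHull ℝ V ↔ ∃ l : Fin n → ℝ, (∀ i, |l i| ≤ 1) ∧
      x = t + ∑ i, l i • y i := fun {x} => by rw [hy, mem_zonotope_iff]
  obtain ⟨lu, hlu, hu⟩ := hmem.1 (subset_convexHull ℝ V he.left_mem)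
  obtain ⟨lv, hlv, hv⟩ := hmem.1 (subset_convexHull ℝ V he.right_mem)
  have huv : projAlong (u - v) v = projAlong (u - v) u := by
    rw [eq_comm, ← sub_eq_zero, ← map_sub, projAlong_self]
  have hdiff : u - v = ∑ i, (lu i - lv i) • y i := by
    conv_lhs => rw [hu, hv]
    simp only [sub_smul, Finset.sum_sub_distrib]
    abel
  set z := u - v with hzdef
  set L := projAlong z with hL
  have hz2 : 0 < ‖z‖ ^ 2 := by
    have := norm_pos_iff.2 hz
    positivity
  set I : Finset (Fin n) := {i | L (y i) = 0} with hI
  have hIy : ∀ i ∈ I, y i = (⟪y i, z⟫_ℝ / ‖z‖ ^ 2) • z := fun i hi => by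
    have hi : L (y i) = 0 := by simpa [hI] using hi
    conv_lhs => rw [eq_projAlong_add z (y i), ← hL, hi, zero_add]
  -- Every fibre over an extreme point has `⟪·, z⟫`-values in an interval of half-width `a`. It is
  -- positive because `u` and `v` share a fibre.
  set a := ∑ i ∈ I, |⟪y i, z⟫_ℝ| with ha
  have hapos : 0 < a := by
    refine lt_of_le_of_ne (Finset.sum_nonneg fun i _ => abs_nonneg _) fun h0 => hz ?_
    rw [hdiff]
    refine Finset.sum_eq_zero fun i _ => ?_
    by_cases hi : i ∈ I
    · have h1 := (Finset.sum_eq_zero_iff_of_nonneg fun i _ => abs_nonneg _).1 h0.symm i hi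
      rw [hIy i hi, abs_eq_zero.1 h1, zero_div, zero_smul, smul_zero]
    · have hi : L (y i) ≠ 0 := by simpa [hI] using hi
      rw [coeff_eq_of_mem_extremePoints hy L hm hlu hlv (by rw [← hu]) (by rw [← hv, huv]) hi,
        sub_self, zero_smul]
  have key : ∀ p ∈ (L '' convexHull ℝ V).extremePoints ℝ, ∀ l : Fin n → ℝ, (∀ i, |l i| ≤ 1) →
      L (t + ∑ i, l i • y i) = p → ∀ σ : ℝ, |σ| = 1 →
      ∃ x ∈ V, L x = p ∧ ⟪x, z⟫_ℝ = ⟪t, z⟫_ℝ + (∑ i ∈ Iᶜ, l i * ⟪y i, z⟫_ℝ) + σ * a := by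
    intro p hp l hl hlp σ hσ
    have hσσ : σ * σ = 1 := by rw [← abs_mul_abs_self, hσ, one_mul]
    -- Pushing all generators parallel to `z` to the extreme chosen by `σ` gives an end of the
    -- fibre. This end is a vertex, since it is the only maximizer of `σ * ⟪·, z⟫` on the fibre over
    -- an extreme point.
    set m : Fin n → ℝ := fun i => if i ∈ I then σ * SignType.sign ⟪y i, z⟫_ℝ else l i with hmdef
    have hm1 : ∀ i, |m i| ≤ 1 := fun i => by
      simp only [hmdef]
      split_ifs
      · rw [abs_mul, hσ, one_mul]
        rcases lt_trichotomy ⟪y i, z⟫_ℝ 0 with h | h | h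
        · simp [sign_neg h]
        · simp [h]
        · simp [sign_pos h]
      · exact hl i
    set x := t + ∑ i, m i • y i with hx
    have hinner : ∀ k : Fin n → ℝ, ⟪t + ∑ i, k i • y i, z⟫_ℝ =
        ⟪t, z⟫_ℝ + (∑ i ∈ Iᶜ, k i * ⟪y i, z⟫_ℝ) + ∑ i ∈ I, k i * ⟪y i, z⟫_ℝ := fun k => by
      rw [inner_add_left, sum_inner, ← Finset.sum_compl_add_sum I, add_assoc]
      simp only [inner_smul_left, conj_trivial]
    have hLx : L x = p := by
      rw [← hlp, hx]
      simp only [map_add, map_sum, map_smul]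
      congr 1
      refine Finset.sum_congr rfl fun i _ => ?_
      by_cases hi : i ∈ I
      · have hi' : L (y i) = 0 := by simpa [hI] using hi
        rw [hi', smul_zero, smul_zero]
      · simp only [hmdef, if_neg hi]
    have hsumI : ∑ i ∈ I, m i * ⟪y i, z⟫_ℝ = σ * a := by
      rw [ha, Finset.mul_sum]
      refine Finset.sum_congr rfl fun i hi => ?_
      simp only [hmdef, if_pos hi]
      rw [mul_assoc, sign_mul_self]
    have hxz : ⟪x, z⟫_ℝ = ⟪t, z⟫_ℝ + (∑ i ∈ Iᶜ, l i * ⟪y i, z⟫_ℝ) + σ * a := by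
      rw [hx, hinner, hsumI]
      congr 2
      refine Finset.sum_congr rfl fun i hi => ?_
      simp only [hmdef, if_neg (Finset.mem_compl.1 hi)]
    have hxV : x ∈ convexHull ℝ V := hmem.2 ⟨m, hm1, rfl⟩
    have hmax : ∀ w ∈ convexHull ℝ V, L w = p → σ * ⟪w, z⟫_ℝ ≤ σ * ⟪x, z⟫_ℝ := fun w hw hwp => by
      obtain ⟨k, hk, rfl⟩ := hmem.1 hw
      have h1 : ∑ i ∈ Iᶜ, k i * ⟪y i, z⟫_ℝ = ∑ i ∈ Iᶜ, l i * ⟪y i, z⟫_ℝ := by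
        refine Finset.sum_congr rfl fun i hi => ?_
        have hi : L (y i) ≠ 0 := by simpa [hI] using hi
        rw [coeff_eq_of_mem_extremePoints hy L hp hk hl hwp hlp hi]
      have h2 : σ * ∑ i ∈ I, k i * ⟪y i, z⟫_ℝ ≤ a := by
        rw [Finset.mul_sum]
        refine Finset.sum_le_sum fun i _ => (le_abs_self _).trans ?_
        rw [abs_mul, abs_mul, hσ, one_mul]
        exact mul_le_of_le_one_left (abs_nonneg _) (hk i)
      rw [hinner, hxz, h1, mul_add, mul_add σ _ (σ * a), ← mul_assoc σ σ, hσσ, one_mul]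
      linarith
    refine ⟨x, ?_, hLx, hxz⟩
    refine extremePoints_convexHull_subset (mem_extremePoints_iff_left.2 ⟨hxV, ?_⟩)
    rintro w hw w' hw' ⟨α, β, hα, hβ, hαβ, hxw⟩
    have hLw : p ∈ openSegment ℝ (L w) (L w') :=
      ⟨α, β, hα, hβ, hαβ, by rw [← map_smul, ← map_smul, ← map_add, hxw, hLx]⟩
    obtain ⟨h1, h2⟩ := (mem_extremePoints.1 hp).2 _ ⟨w, hw, rfl⟩ _ ⟨w', hw', rfl⟩ hLw
    have h3 := hmax w hw h1
    have h4 := hmax w' hw' h2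
    have h5 : α * (σ * ⟪w, z⟫_ℝ) + β * (σ * ⟪w', z⟫_ℝ) = σ * ⟪x, z⟫_ℝ := by
      rw [← hxw, inner_add_left, inner_smul_left, inner_smul_left, conj_trivial, conj_trivial]
      ring
    have h6 : σ * ⟪w, z⟫_ℝ = σ * ⟪x, z⟫_ℝ := by
      refine le_antisymm h3 ?_
      by_contra! hc
      obtain rfl : β = 1 - α := by linarith
      nlinarith [mul_pos hα (sub_pos.2 hc), mul_nonneg hβ.le (sub_nonneg.2 h4)]
    have h7 : ⟪w, z⟫_ℝ = ⟪x, z⟫_ℝ := by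
      refine mul_left_cancel₀ (fun h => ?_) h6
      rw [h, mul_zero] at hσσ
      exact zero_ne_one hσσ
    rw [eq_projAlong_add z w, eq_projAlong_add z x, h7, ← hL, h1, hLx]
  have hρ : ∀ p ∈ (L '' convexHull ℝ V).extremePoints ℝ,
      ‖p‖ ^ 2 = r ^ 2 - a ^ 2 / ‖z‖ ^ 2 ∧ p ∈ convexHull ℝ V := fun p hp => by
    obtain ⟨w, hw, hwp⟩ := hp.1
    obtain ⟨l, hl, rfl⟩ := hmem.1 hw
    obtain ⟨x₁, hx₁, hL₁, hi₁⟩ := key p hp l hl hwp 1 abs_one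
    obtain ⟨x₂, hx₂, hL₂, hi₂⟩ := key p hp l hl hwp (-1) (by rw [abs_neg, abs_one])
    have e1 := norm_projAlong_sq hz x₁
    have e2 := norm_projAlong_sq hz x₂
    rw [← hL, hL₁, hr x₁ hx₁] at e1
    rw [← hL, hL₂, hr x₂ hx₂] at e2
    have h1 : ⟪x₁, z⟫_ℝ ^ 2 = ⟪x₂, z⟫_ℝ ^ 2 := by
      have : ⟪x₁, z⟫_ℝ ^ 2 / ‖z‖ ^ 2 = ⟪x₂, z⟫_ℝ ^ 2 / ‖z‖ ^ 2 := by linarith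
      exact (div_left_inj' hz2.ne').1 this
    -- The two ends have equal norm and equal projection, so their heights along `z` are opposite
    -- and `p` is their midpoint.
    have h2 : (⟪x₁, z⟫_ℝ + ⟪x₂, z⟫_ℝ) * (2 * a) = 0 := by
      have : ⟪x₁, z⟫_ℝ - ⟪x₂, z⟫_ℝ = 2 * a := by linarith
      rw [← this]
      linear_combination h1
    have h3 := (mul_eq_zero.1 h2).resolve_right (by positivity)
    have h4 : ⟪x₁, z⟫_ℝ = a := by linarith
    have h5 : ⟪x₂, z⟫_ℝ = -a := by linarith
    refine ⟨by rw [e1, h4], ?_⟩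
    have h6 : p = (1 / 2 : ℝ) • x₁ + (1 / 2 : ℝ) • x₂ := by
      rw [eq_projAlong_add z x₁, eq_projAlong_add z x₂, ← hL, hL₁, hL₂, h4, h5, neg_div]
      module
    rw [h6]
    exact convex_convexHull ℝ V (subset_convexHull ℝ V hx₁) (subset_convexHull ℝ V hx₂)
      (by norm_num) (by norm_num) (by norm_num)
  refine ⟨Real.sqrt (r ^ 2 - a ^ 2 / ‖z‖ ^ 2), fun p hp => ⟨?_, (hρ p hp).2⟩⟩
  rw [← (hρ p hp).1, Real.sqrt_sq (norm_nonneg p)]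

/-- The section of an inscribed zonotope with the bisector of an edge is its projection. -/
theorem section_eq_of_isZonotope [FiniteDimensional ℝ E] {V : Set E} (hV : V.Finite) {r : ℝ}
    (hr : ∀ w ∈ V, ‖w‖ = r) (hZ : IsZonotope (convexHull ℝ V)) {u v : E} (he : IsEdgeOf V u v) :
    convexHull ℝ V ∩ {x | ⟪x, u - v⟫_ℝ = 0} = projAlong (u - v) '' convexHull ℝ V := by
  refine Set.Subset.antisymm ?_ ?_
  · rintro x ⟨hx, hxz⟩
    exact ⟨x, hx, projAlong_eq_self hxz⟩
  · intro x hx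
    refine ⟨?_, ?_⟩
    · obtain ⟨ρ, hρ⟩ := norm_eq_of_isZonotope hV hr hZ he
      have hSeq := (projAlong (u - v)).image_convexHull V
      have hKM := convexHull_extremePoints_eq (S := projAlong (u - v) '' convexHull ℝ V)
        (by rw [hSeq]; exact (hV.image _).isCompact_convexHull ℝ)
        (by rw [hSeq]; exact convex_convexHull ℝ _)
        (by rw [hSeq]; exact (hV.image _).subset extremePoints_convexHull_subset)
      rw [← hKM] at hx
      exact convexHull_min (fun p hp => (hρ p hp).2) (convex_convexHull ℝ V) hx
    · obtain ⟨y, -, rfl⟩ := hx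
      exact inner_projAlong_self _ y

/-! ### Back to bisectors, exposed edges and an arbitrary center -/

lemma mem_bisector_iff {u v c x : E} (hc : dist u c = dist v c) :
    x ∈ bisector u v ↔ ⟪x - c, u - v⟫_ℝ = 0 := by
  rw [bisector, AffineSubspace.mem_perpBisector_iff_dist_eq, dist_eq_norm, dist_eq_norm,
    ← pow_left_inj₀ (norm_nonneg _) (norm_nonneg _) two_ne_zero]
  rw [dist_eq_norm, dist_eq_norm] at hc
  have e1 := norm_sub_sq_real (x - c) (u - c)
  have e2 := norm_sub_sq_real (x - c) (v - c)
  rw [sub_sub_sub_cancel_right] at e1 e2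
  have e3 : ⟪x - c, u - v⟫_ℝ = ⟪x - c, u - c⟫_ℝ - ⟪x - c, v - c⟫_ℝ := by
    rw [← inner_sub_right, sub_sub_sub_cancel_right]
  rw [e1, e2, e3, hc]
  constructor <;> intro h <;> linarith

lemma bisectorProj_eq [FiniteDimensional ℝ E] {u v c : E} (hc : dist u c = dist v c) (x : E) :
    bisectorProj u v x = projAlong (u - v) (x - c) + c := by
  have hcb : c ∈ bisector u v := (mem_bisector_iff hc).2 (by rw [sub_self, inner_zero_left])
  rw [bisectorProj, EuclideanGeometry.orthogonalProjection_apply_mem _ hcb, vadd_eq_add, vsub_eq_sub]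
  congr 1
  rw [← Submodule.starProjection_apply]
  have hdir : ∀ w, w ∈ (bisector u v).direction ↔ ⟪w, u - v⟫_ℝ = 0 := fun w => by
    rw [bisector, AffineSubspace.direction_perpBisector, vsub_eq_sub, ← neg_sub u v,
      Submodule.mem_orthogonal_singleton_iff_inner_left, inner_neg_right, neg_eq_zero]
  refine Submodule.eq_starProjection_of_mem_of_inner_eq_zero ((hdir _).2 (inner_projAlong_self _ _))
    fun w hw => ?_
  rw [projAlong_apply, sub_sub_cancel, inner_smul_left, real_inner_comm w (u - v), (hdir w).1 hw, mul_zero]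

lemma add_mem_extremePoints_image {A : Set E} {p : E} (c : E) :
    p + c ∈ ((fun x => x + c) '' A).extremePoints ℝ ↔ p ∈ A.extremePoints ℝ := by
  have h : ∀ x y z : E, x + c ∈ openSegment ℝ (y + c) (z + c) ↔ x ∈ openSegment ℝ y z :=
    fun x y z => by
      rw [add_comm x, add_comm y, add_comm z]
      exact mem_openSegment_translate ℝ c
  have hmem : p + c ∈ (fun x => x + c) '' A ↔ p ∈ A :=
    (add_left_injective c).mem_set_image
  simp only [mem_extremePoints_iff_left, Set.forall_mem_image, hmem, h, add_left_inj]

lemma forall_extremePoints_image_add {A : Set E} {c : E} {ρ : ℝ} :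
    (∀ v ∈ vertices ((fun x => x + c) '' A), dist v c = ρ) ↔
      ∀ p ∈ A.extremePoints ℝ, ‖p‖ = ρ := by
  constructor
  · intro h p hp
    have := h (p + c) ((add_mem_extremePoints_image c).2 hp)
    rwa [dist_eq_norm, add_sub_cancel_right] at this
  · intro h v hv
    rw [dist_eq_norm]
    exact h _ ((add_mem_extremePoints_image c).1 (by rwa [sub_add_cancel]))

lemma isExposed_segment_of_isEdgeOf {V : Set E} (hV : V.Finite) {u v : E} (he : IsEdgeOf V u v) :
    IsEdge (convexHull ℝ V) u v := by
  obtain ⟨huv, g, hg⟩ := he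
  have hu : u ∈ face V g := by simp [hg]
  have hv : v ∈ face V g := by simp [hg]
  refine ⟨huv, fun _ => ⟨innerSL ℝ g, Set.ext fun x => ⟨fun hx => ?_, fun hx => ?_⟩⟩⟩
  · refine ⟨(convex_convexHull ℝ V).segment_subset (subset_convexHull ℝ V hu.1)
      (subset_convexHull ℝ V hv.1) hx, fun y hy => ?_⟩
    have hgx : ⟪g, x⟫_ℝ = ⟪g, u⟫_ℝ := by
      obtain ⟨s, t, -, -, hst, rfl⟩ := hx
      rw [inner_add_right, inner_smul_right, inner_smul_right, face_inner_eq hv hu, ← add_mul, hst,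
        one_mul]
    simp only [innerSL_apply_apply, hgx]
    exact inner_le_of_mem_convexHull hu.2 hy
  · rw [← convexHull_pair, ← hg]
    exact mem_convexHull_face hV hx.1 fun w hw => hx.2 w (subset_convexHull ℝ V hw)

/-- The exposing functional has its face of `V` inside the segment. Each endpoint is extreme in the
segment, hence belongs to that face, and a line meets the sphere in no third point. -/
lemma isEdgeOf_of_isExposed_segment [FiniteDimensional ℝ E] {V : Set E} (hV : V.Finite) {c : E}
    {r : ℝ} (hr : ∀ w ∈ V, dist w c = r) {u v : E} (he : IsEdge (convexHull ℝ V) u v) :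
    IsEdgeOf V u v := by
  obtain ⟨huv, hexp⟩ := he
  obtain ⟨f, hf⟩ := hexp ⟨u, left_mem_segment ℝ u v⟩
  set g := (InnerProductSpace.toDual ℝ E).symm f
  have hfg : ∀ y, f y = ⟪g, y⟫_ℝ := fun y =>
    (InnerProductSpace.toDual_symm_apply (x := y) (y := f)).symm
  simp only [hfg] at hf
  have hsub : face V g ⊆ segment ℝ u v := fun w hw => by
    rw [hf]
    exact ⟨subset_convexHull ℝ V hw.1, fun y hy => inner_le_of_mem_convexHull hw.2 hy⟩
  have hfin : (face V g).Finite := hV.subset (face_subset V g)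
  have hend : ∀ a b : E, a ≠ b → segment ℝ u v = segment ℝ a b → a ∈ face V g := fun a b hab hs => by
    have ha : a ∈ segment ℝ u v := hs ▸ left_mem_segment ℝ a b
    rw [hf] at ha
    have h1 : a ∈ convexHull ℝ (face V g) :=
      mem_convexHull_face hV ha.1 fun w hw => ha.2 w (subset_convexHull ℝ V hw)
    have hpos : 0 < ⟪a - b, a - b⟫_ℝ := real_inner_self_pos.2 (sub_ne_zero.2 hab)
    have h2 : ∀ w ∈ face V g, ⟪a - b, w⟫_ℝ ≤ ⟪a - b, a⟫_ℝ ∧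
        (⟪a - b, a⟫_ℝ ≤ ⟪a - b, w⟫_ℝ → w = a) := fun w hw => by
      have h3 := hsub hw
      rw [hs, segment_eq_image'] at h3
      obtain ⟨t, ht, rfl⟩ := h3
      simp only
      have h4 : ⟪a - b, a + t • (b - a)⟫_ℝ = ⟪a - b, a⟫_ℝ - t * ⟪a - b, a - b⟫_ℝ := by
        rw [inner_add_right, inner_smul_right, ← neg_sub a b, inner_neg_right]
        ring
      rw [h4]
      refine ⟨by nlinarith [ht.1], fun h5 => ?_⟩
      have : t = 0 := by
        refine le_antisymm ?_ ht.1
        by_contra! hc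
        nlinarith
      rw [this, zero_smul, add_zero]
    have h3 := mem_convexHull_face (g := a - b) hfin h1 fun w hw => (h2 w hw).1
    obtain ⟨w, hw⟩ := convexHull_nonempty_iff.1 ⟨a, h3⟩
    have h4 := inner_le_of_mem_convexHull (g := a - b) (M := ⟪a - b, w⟫_ℝ) hw.2 h1
    exact (h2 w hw.1).2 h4 ▸ hw.1
  have hu := hend u v huv rfl
  have hv := hend v u huv.symm (segment_symm ℝ u v)
  refine ⟨huv, g, Set.Subset.antisymm (fun w hw => ?_) (Set.pair_subset hu hv)⟩
  have h1 := hsub hw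
  rw [segment_eq_image'] at h1
  obtain ⟨t, -, rfl⟩ := h1
  have hn : ∀ x ∈ face V g, ‖x - c‖ = ‖u - c‖ := fun x hx => by
    rw [← dist_eq_norm, ← dist_eq_norm, hr x hx.1, hr u hu.1]
  rcases eq_zero_or_eq_one_of_norm_eq (u := u - c) (a := v - u) (t := t) (sub_ne_zero.2 huv.symm)
    (by rw [sub_add_sub_cancel', hn v hv])
    (by rw [← hn _ hw, sub_add_eq_add_sub]) with rfl | rfl
  · left
    simp
  · right
    simp

/-- The projection is an affine map fixing `c`, which lies on the bisector. -/
lemma mem_affineSpan_bisectorProj [FiniteDimensional ℝ E] {P : Set E} {u v c : E}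
    (hc : dist u c = dist v c) (h : c ∈ affineSpan ℝ P) :
    c ∈ affineSpan ℝ (bisectorProj u v '' P) := by
  set f : E →ᵃ[ℝ] E := (projAlong (u - v)).toAffineMap +
    AffineMap.const ℝ E (c - projAlong (u - v) c) with hf
  have hfx : ∀ x, f x = bisectorProj u v x := fun x => by
    rw [bisectorProj_eq hc, map_sub]
    simp only [hf, AffineMap.coe_add, Pi.add_apply, LinearMap.coe_toAffineMap, AffineMap.const_apply]
    abel
  have himg : bisectorProj u v '' P = f '' P := Set.image_congr fun x _ => (hfx x).symm
  rw [himg, ← AffineSubspace.map_span]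
  have hfc : f c = c := by rw [hfx, bisectorProj_eq hc, sub_self, map_zero, zero_add]
  have := AffineSubspace.mem_map_of_mem f h
  rwa [hfc] at this

/-- An inscribed polytope is a zonotope if and only if all its projections along edges, equivalently
all its sections with bisectors of edges, are inscribed with the same center. -/
theorem tfae_isZonotope [FiniteDimensional ℝ E] (P : Set E) (hP : IsPolytope P)
    (hI : IsInscribed P) :
    List.TFAE
      [IsZonotope P,
       ∀ u v : E, IsEdge P u v → IsInscribedWithCenter (bisectorProj u v '' P) (center P),
       ∀ u v : E, IsEdge P u v →
        IsInscribedWithCenter (P ∩ (bisector u v : Set E)) (center P)] := by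
  obtain ⟨hcP, r, hr⟩ := isInscribedWithCenter_center hP hI
  set c := center P
  have hPV := hP.convexHull_vertices
  have hVf : (vertices P).Finite := by
    obtain ⟨S, hS, -, rfl⟩ := hP
    exact hS.subset extremePoints_convexHull_subset
  have hVne : (vertices P).Nonempty := by
    rw [← convexHull_nonempty_iff (𝕜 := ℝ), hPV]
    obtain ⟨S, -, hS, rfl⟩ := hP
    exact hS.convexHull
  set V := (fun x => x - c) '' vertices P with hV
  have hVf' : V.Finite := hVf.image _
  have hVr : ∀ w ∈ V, ‖w‖ = r := by
    rintro _ ⟨w, hw, rfl⟩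
    rw [← dist_eq_norm]
    exact hr w hw
  have hconv : P = (fun x => x + c) '' convexHull ℝ V := by
    have h1 : vertices P = (AffineEquiv.vaddConst ℝ c : E →ᵃ[ℝ] E) '' V := by
      rw [hV, Set.image_image]
      simp
    conv_lhs => rw [← hPV, h1, ← AffineMap.image_convexHull]
    rfl
  have hconv' : convexHull ℝ V = (fun x => x + -c) '' P := by
    conv_rhs => rw [hconv, Set.image_image]
    simp
  have hedge : ∀ {u v}, IsEdge P u v ↔ IsEdgeOf V (u - c) (v - c) := fun {u v} => by
    rw [hV, isEdgeOf_image_sub, sub_add_cancel, sub_add_cancel]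
    constructor
    · intro he
      rw [← hPV] at he
      exact isEdgeOf_of_isExposed_segment hVf hr he
    · intro he
      have := isExposed_segment_of_isEdgeOf hVf he
      rwa [hPV] at this
  have hdist : ∀ {u v}, IsEdge P u v → dist u c = dist v c := fun {u v} he => by
    have he' := hedge.1 he
    rw [dist_eq_norm, dist_eq_norm, hVr _ he'.left_mem, hVr _ he'.right_mem]
  have hproj : ∀ {u v}, IsEdge P u v →
      bisectorProj u v '' P = (fun x => x + c) '' (projAlong (u - v) '' convexHull ℝ V) :=
    fun {u v} he => by
      rw [hconv', Set.image_image, Set.image_image]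
      refine Set.image_congr fun x _ => ?_
      rw [bisectorProj_eq (hdist he), ← sub_eq_add_neg]
  have hsec : ∀ {u v}, IsEdge P u v → P ∩ (bisector u v : Set E) =
      (fun x => x + c) '' (convexHull ℝ V ∩ {x | ⟪x, u - v⟫_ℝ = 0}) := fun {u v} he => by
    ext x
    constructor
    · rintro ⟨hx, hxb⟩
      refine ⟨x - c, ⟨?_, (mem_bisector_iff (hdist he)).1 hxb⟩, sub_add_cancel x c⟩
      rw [hconv']
      exact ⟨x, hx, (sub_eq_add_neg x c).symm⟩
    · rintro ⟨y, ⟨hy, hyz⟩, rfl⟩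
      refine ⟨?_, (mem_bisector_iff (hdist he)).2 ?_⟩
      · rw [hconv]
        exact ⟨y, hy, rfl⟩
      · rwa [add_sub_cancel_right]
  have hzono : HasTranslatedEdges V → IsZonotope P := fun hB => by
    rw [hconv]
    exact (hB.isZonotope hVf' (hVne.image _) hVr).image_add c
  -- The radius is not prescribed by the hypotheses, but the edge midpoint is an extreme point of
  -- both the projection and the section and thus determines it.
  have hmid : ∀ {u v : E} {A : Set E} {ρ : ℝ},
      (1 / 2 : ℝ) • (u + v) ∈ A.extremePoints ℝ → (∀ p ∈ A.extremePoints ℝ, ‖p‖ = ρ) →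
      ∀ p ∈ A.extremePoints ℝ, ‖p‖ = ‖u + v‖ / 2 := fun {u v A ρ} hm hA p hp => by
    rw [hA p hp, ← hA _ hm, norm_smul, Real.norm_of_nonneg (by norm_num), one_div, div_eq_inv_mul]
  tfae_have 1 → 2 := fun hZ u v he => by
    refine ⟨mem_affineSpan_bisectorProj (hdist he) hcP, ?_⟩
    have hZ' : IsZonotope (convexHull ℝ V) := hconv' ▸ hZ.image_add (-c)
    obtain ⟨ρ, hρ⟩ := norm_eq_of_isZonotope hVf' hVr hZ' (hedge.1 he)
    rw [sub_sub_sub_cancel_right] at hρ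
    rw [hproj he]
    exact ⟨ρ, forall_extremePoints_image_add.2 fun p hp => (hρ p hp).1⟩
  tfae_have 1 → 3 := fun hZ u v he => by
    have hZ' : IsZonotope (convexHull ℝ V) := hconv' ▸ hZ.image_add (-c)
    have hse := section_eq_of_isZonotope hVf' hVr hZ' (hedge.1 he)
    rw [sub_sub_sub_cancel_right] at hse
    rw [hsec he, hse, ← hproj he]
    refine ⟨mem_affineSpan_bisectorProj (hdist he) hcP, ?_⟩
    obtain ⟨ρ, hρ⟩ := norm_eq_of_isZonotope hVf' hVr hZ' (hedge.1 he)
    rw [sub_sub_sub_cancel_right] at hρ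
    rw [hproj he]
    exact ⟨ρ, forall_extremePoints_image_add.2 fun p hp => (hρ p hp).1⟩
  tfae_have 2 → 1 := fun h => by
    refine hzono (hasTranslatedEdges_of_projections hVf' hVr fun u v he => ?_)
    have he' : IsEdge P (u + c) (v + c) := by
      rw [hedge, add_sub_cancel_right, add_sub_cancel_right]
      exact he
    obtain ⟨-, ρ, hρ⟩ := h _ _ he'
    rw [hproj he', add_sub_add_right_eq_sub, forall_extremePoints_image_add] at hρ
    refine hmid ?_ hρ
    rw [← projAlong_sub_left ((hVr u he.left_mem).trans (hVr v he.right_mem).symm) he.1]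
    exact he.projAlong_mem_extremePoints hVf'
  tfae_have 3 → 1 := fun h => by
    refine hzono (hasTranslatedEdges_of_sections hVf' hVr fun u v he => ?_)
    have he' : IsEdge P (u + c) (v + c) := by
      rw [hedge, add_sub_cancel_right, add_sub_cancel_right]
      exact he
    obtain ⟨-, ρ, hρ⟩ := h _ _ he'
    rw [hsec he', add_sub_add_right_eq_sub, forall_extremePoints_image_add] at hρ
    have huv := (hVr v he.right_mem).trans (hVr u he.left_mem).symm
    refine hmid ?_ hρ
    refine mem_extremePoints_section hVf' he (norm_inner_sub_pos huv.symm he.1).1.ne'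
      ⟨1 / 2, 1 / 2, by norm_num, by norm_num, by norm_num, by rw [smul_add]⟩ ?_
    rw [inner_smul_left, inner_add_sub_eq_zero huv, mul_zero]
  tfae_finish

end InscribedZonotope

theorem theorem1p1 {E : Type*} [NormedAddCommGroup E] [InnerProductSpace ℝ E]
    [FiniteDimensional ℝ E] (P : Set E) (hP : InscribedZonotope.IsPolytope P)
    (hI : InscribedZonotope.IsInscribed P) :
    List.TFAE
      [InscribedZonotope.IsZonotope P,
       ∀ u v : E, InscribedZonotope.IsEdge P u v →
        InscribedZonotope.IsInscribedWithCenter (InscribedZonotope.bisectorProj u v '' P)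
          (InscribedZonotope.center P),
       ∀ u v : E, InscribedZonotope.IsEdge P u v →
        InscribedZonotope.IsInscribedWithCenter (P ∩ (InscribedZonotope.bisector u v : Set E))
          (InscribedZonotope.center P)] :=
  InscribedZonotope.tfae_isZonotope P hP hI
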